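/- Let $n\ge 2$ and let $\Omega\subset\mathbb R^n$ be a bounded domain with $C^\infty$ boundary and unit outer normal $n(x)$, and put $\Gamma_\pm=\{(x,v)\in\partial\Omega\times\mathbb R^n:\ \pm\, n(x)\cdot v>0\}$ and $\tau_\pm(x,v)=\sup\{s\ge 0:\ x\pm sv\in\Omega\}$ for $v\neq 0$ (with $\sup\emptyset=0$). For a kernel $B\in C(\mathbb R^n\times\mathbb R^n\times\mathbb S^{n-1})$ consider the boundary value problem $$v\cdot\nabla_xF=\int_{\mathbb R^n}\int_{\mathbb S^{n-1}}B(v,u,\omega)\,[F(x,u')F(x,v')-F(x,u)F(x,v)]\,d\omega\,du\ \text{ in }\Omega\times\mathbb R^n,\qquad F=g\ \text{ on }\Gamma_-,$$ where $u'=u-[(u-v)\cdot\omega]\omega$ and $v'=v+[(u-v)\cdot\omega]\omega$. Solutions are bounded measurable functions $F$ that satisfy the equation, for $v\ne0$, in integrated form along the characteristics $s\mapsto(x+sv,v)$ in $\Omega$ and attain the value $g$ on $\Gamma_-$ along them. Let $B_1,B_2\in C(\mathbb R^n\times\mathbb R^n\times\mathbb S^{n-1})$ be two kernels such that, for $j=1,2$: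 (a) there is $M>0$ with $\tau_\pm(x,v)\int_{\mathbb R^n}\int_{\mathbb S^{n-1}}|B_j(v,u,\omega)|\,d\omega\,du<M$ for all $x\in\overline\Omega$ and $v\in\mathbb R^n\setminus\{0\}$; (b) $B_j(v,u,\omega)=B_j(u,v,\omega)$ and $B_j(v,u,-\omega)=B_j(v,u,\omega)$ for all $v,u\in\mathbb R^n$, $\omega\in\mathbb S^{n-1}$. Suppose that $B_1$ and $B_2$ have identical boundary measurements for small data: there are $\varepsilon,\delta>0$ such that for every continuous $g$ on $\Gamma_-$ with $|g|\le\varepsilon$, and all solutions $F_1,F_2$ of the problem with datum $g$ and kernels $B_1,B_2$ respectively that satisfy $|F_j|\le\delta$, the outgoing traces $\lim_{t\downarrow0}F_j(x-tv,v)$, $j=1,2$, coincide at every $(x,v)\in\Gamma_+$ whose backward trajectory in $\Omega$ starts at a point of $\Gamma_-$ (for convex $\Omega$ these are all points of $\Gamma_+$; in general only trajectories that enter $\Omega$ tangentially are left out). Then $B_1=B_2$ everywhere on $\mathbb R^n\times\mathbb R^n\times\mathbb S^{n-1}$ in each of the following two cases: 1. $B_1$ and $B_2$ are both independent of $\omega$;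 2. $B_1\ge B_2$ pointwise. -/

import Mathlib

open MeasureTheory Set Filter Topology
open scoped ENNReal

namespace Boltzmann

/-- Position and velocity space `ℝⁿ` with its Euclidean norm. -/
abbrev Space (n : ℕ) : Type := EuclideanSpace ℝ (Fin n)

/-- The unit sphere `𝕊ⁿ⁻¹`. -/
abbrev USphere (n : ℕ) : Type := Metric.sphere (0 : Space n) 1

/-- A collision kernel `B(v, u, ω)`. -/
abbrev Kernel (n : ℕ) : Type := Space n → Space n → USphere n → ℝ

/-- The surface measure `dω` on `𝕊ⁿ⁻¹`. -/
noncomputable def sphereMeasure (n : ℕ) : Measure (USphere n) :=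
  (volume : Measure (Space n)).toSphere

/-! ### The domain, its boundary and the exit times -/

/-- `ρ` is a smooth defining function of `Ω` on the open neighbourhood `U` of `x`: it has no
critical point in `U`, and `Ω ∩ U = {ρ < 0} ∩ U`. -/
structure IsDefiningFunction {n : ℕ} (Ω : Set (Space n)) (x : Space n) (U : Set (Space n))
    (ρ : Space n → ℝ) : Prop where
  isOpen : IsOpen U
  mem : x ∈ U
  smooth : ContDiffOn ℝ ((⊤ : ℕ∞) : WithTop ℕ∞) ρ U
  gradient_ne_zero : ∀ y ∈ U, gradient ρ y ≠ 0
  mem_iff : ∀ y ∈ U, y ∈ Ω ↔ ρ y < 0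

/-- A bounded domain of `ℝⁿ` with `C^∞` boundary. -/
structure IsSmoothBoundedDomain {n : ℕ} (Ω : Set (Space n)) : Prop where
  isOpen : IsOpen Ω
  isConnected : IsConnected Ω
  isBounded : Bornology.IsBounded Ω
  smooth_boundary : ∀ x ∈ frontier Ω, ∃ U ρ, IsDefiningFunction Ω x U ρ

/-- `ν` is the unit outer normal to `∂Ω` at `x`. -/
def IsOuterNormal {n : ℕ} (Ω : Set (Space n)) (x ν : Space n) : Prop :=
  ‖ν‖ = 1 ∧ ∃ U ρ, IsDefiningFunction Ω x U ρ ∧ gradient ρ x = ‖gradient ρ x‖ • ν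

/-- `Γ₋ = {(x, v) : x ∈ ∂Ω, n(x) · v < 0}`. -/
def incoming {n : ℕ} (Ω : Set (Space n)) : Set (Space n × Space n) :=
  {p | p.1 ∈ frontier Ω ∧ ∃ ν, IsOuterNormal Ω p.1 ν ∧ inner ℝ ν p.2 < 0}

/-- `Γ₊ = {(x, v) : x ∈ ∂Ω, n(x) · v > 0}`. -/
def outgoing {n : ℕ} (Ω : Set (Space n)) : Set (Space n × Space n) :=
  {p | p.1 ∈ frontier Ω ∧ ∃ ν, IsOuterNormal Ω p.1 ν ∧ 0 < inner ℝ ν p.2}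

/-- The points `(x, v)` of `Γ₊` at which the trajectory arriving with velocity `v` has entered `Ω`
through `Γ₋`. For convex `Ω` this is all of `Γ₊`. For non-convex `Ω` a null set of trajectories
enters `Ω` tangentially, at a boundary point outside `Γ₋`; no incoming datum is prescribed
there, and the incoming data do not determine the solution on these trajectories. -/
def transversalOutgoing {n : ℕ} (Ω : Set (Space n)) : Set (Space n × Space n) :=
  {p | p ∈ outgoing Ω ∧ ∃ t : ℝ, 0 < t ∧ (p.1 - t • p.2, p.2) ∈ incoming Ω ∧
    ∀ s ∈ Ioo 0 t, p.1 - s • p.2 ∈ Ω}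

/-- `τ₊(x, v) = sup {s ≥ 0 : x + s v ∈ Ω}`. -/
noncomputable def tauPlus {n : ℕ} (Ω : Set (Space n)) (x v : Space n) : ℝ≥0∞ :=
  ⨆ (s : ℝ) (_ : 0 ≤ s ∧ x + s • v ∈ Ω), ENNReal.ofReal s

/-- `τ₋(x, v) = sup {s ≥ 0 : x - s v ∈ Ω}`. -/
noncomputable def tauMinus {n : ℕ} (Ω : Set (Space n)) (x v : Space n) : ℝ≥0∞ :=
  ⨆ (s : ℝ) (_ : 0 ≤ s ∧ x - s • v ∈ Ω), ENNReal.ofReal s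

/-! ### Assumptions on the collision kernel -/

/-- `∫_{ℝⁿ} ∫_{𝕊ⁿ⁻¹} |B(v, u, ω)| dω du`. -/
noncomputable def kernelMass {n : ℕ} (B : Kernel n) (v : Space n) : ℝ≥0∞ :=
  ∫⁻ u : Space n, ∫⁻ ω : USphere n, ‖B v u ω‖ₑ ∂(sphereMeasure n)

/-- `B ∈ C(ℝⁿ × ℝⁿ × 𝕊ⁿ⁻¹)`. -/
def IsContinuousKernel {n : ℕ} (B : Kernel n) : Prop :=
  Continuous fun p : Space n × Space n × USphere n => B p.1 p.2.1 p.2.2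

/-- There is a finite `M > 0` with `τ_±(x, v) ∫∫ |B(v, u, ω)| dω du < M` for all `x` in the closure
of `Ω` and all `v ≠ 0`. -/
def KernelBound {n : ℕ} (Ω : Set (Space n)) (B : Kernel n) : Prop :=
  ∃ M : ℝ, 0 < M ∧ ∀ x ∈ closure Ω, ∀ v : Space n, v ≠ 0 →
    tauPlus Ω x v * kernelMass B v < ENNReal.ofReal M ∧
    tauMinus Ω x v * kernelMass B v < ENNReal.ofReal M

/-- `B(v, u, ω) = B(u, v, ω)` and `B(v, u, -ω) = B(v, u, ω)`. -/
def KernelSymmetric {n : ℕ} (B : Kernel n) : Prop :=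
  (∀ v u ω, B v u ω = B u v ω) ∧ (∀ v u ω, B v u (-ω) = B v u ω)

/-! ### The Boltzmann equation -/

/-- `u' = u - [(u - v) · ω] ω`. -/
noncomputable def uPrime {n : ℕ} (v u : Space n) (ω : USphere n) : Space n :=
  u - (inner ℝ (u - v) (ω : Space n)) • (ω : Space n)

/-- `v' = v + [(u - v) · ω] ω`. -/
noncomputable def vPrime {n : ℕ} (v u : Space n) (ω : USphere n) : Space n :=
  v + (inner ℝ (u - v) (ω : Space n)) • (ω : Space n)

/-- The collision operator
`Q(H₁, H₂)(x, v) = ∫∫ B(v, u, ω) [H₁(x, u') H₂(x, v') - H₁(x, u) H₂(x, v)] dω du`. -/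
noncomputable def collision {n : ℕ} (B : Kernel n) (H₁ H₂ : Space n → Space n → ℝ)
    (x v : Space n) : ℝ :=
  ∫ u : Space n, ∫ ω : USphere n,
    B v u ω * (H₁ x (uPrime v u ω) * H₂ x (vPrime v u ω) - H₁ x u * H₂ x v) ∂(sphereMeasure n)

/-- `F` is a solution of `v · ∇ₓ F = Q(F, F)` in `Ω × ℝⁿ`, `F = g` on `Γ₋`, with `|F| ≤ δ`.

The transport equation is integrated along the characteristics `s ↦ (x + s v, v)` inside `Ω`, and
the boundary value is attained along them. Under `KernelBound` a continuous kernel has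
`B(0, ·, ·) = 0`, so there is no condition at `v = 0`. -/
structure IsSmallSolution {n : ℕ} (Ω : Set (Space n)) (B : Kernel n) (δ : ℝ)
    (g : Space n × Space n → ℝ) (F : Space n → Space n → ℝ) : Prop where
  measurable : Measurable (Function.uncurry F)
  bound : ∀ x ∈ Ω, ∀ v, |F x v| ≤ δ
  transport : ∀ x ∈ Ω, ∀ v : Space n, v ≠ 0 → ∀ t : ℝ, 0 ≤ t →
    (∀ s ∈ Icc 0 t, x + s • v ∈ Ω) →
      F (x + t • v) v - F x v = ∫ s in (0 : ℝ)..t, collision B F F (x + s • v) v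
  inflow : ∀ p ∈ incoming Ω, Tendsto (fun t : ℝ => F (p.1 + t • p.2) p.2) (𝓝[>] 0) (𝓝 (g p))

/-- `h` is the outgoing measurement on `Γ₊` for the incoming datum `g`, that is, the trace
`h(x, v) = lim_{t ↓ 0} F(x - t v, v)` of a solution `F` with `|F| ≤ δ` and `F = g` on `Γ₋`. This is
the graph of the boundary operator `𝒜 : F|_{Γ₋} ↦ F|_{Γ₊}`. -/
def IsMeasurement {n : ℕ} (Ω : Set (Space n)) (B : Kernel n) (δ : ℝ)
    (g h : Space n × Space n → ℝ) : Prop :=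
  ∃ F, IsSmallSolution Ω B δ g F ∧
    ∀ p ∈ outgoing Ω, Tendsto (fun t : ℝ => F (p.1 - t • p.2) p.2) (𝓝[>] 0) (𝓝 (h p))

/-- `𝒜₁(g) = 𝒜₂(g)` for all `g ∈ C(Γ₋)` with `‖g‖ ≤ ε`, for some `ε > 0`; the operators `𝒜ⱼ` are
given by the solutions in a ball of some radius `δ > 0`. -/
def SameMeasurements {n : ℕ} (Ω : Set (Space n)) (B₁ B₂ : Kernel n) : Prop :=
  ∃ ε : ℝ, 0 < ε ∧ ∃ δ : ℝ, 0 < δ ∧ ∀ g : Space n × Space n → ℝ,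
    ContinuousOn g (incoming Ω) → (∀ p ∈ incoming Ω, |g p| ≤ ε) →
      ∀ h₁ h₂, IsMeasurement Ω B₁ δ g h₁ → IsMeasurement Ω B₂ δ g h₂ →
        EqOn h₁ h₂ (transversalOutgoing Ω)

/-- `B(v, u, ω)` does not depend on `ω`. -/
def IndependentOfAngle {n : ℕ} (B : Kernel n) : Prop :=
  ∀ v u ω ω', B v u ω = B v u ω'

end Boltzmann

open MeasureTheory Set Filter Topology
open scoped ENNReal

namespace Boltzmann

variable {n : ℕ} {Ω : Set (Space n)}

/-! ### Trajectories that cross the domain transversally -/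

namespace IsDefiningFunction

variable {x : Space n} {U : Set (Space n)} {ρ : Space n → ℝ}

/-! Only incoming data `l * φ v` that depend on the velocity alone are needed. For small `l > 0` the
integrated equation is a contraction, so each kernel has a solution of size `2 * l`, and along a
trajectory that crosses `Ω` in time `T` the outgoing trace is `l φ(v) + l² T Q(φ, φ)(v) + O(l³)`
(`exists_eq_duhamel`, `exists_isMeasurement`). Dividing by `l²` and letting `l → 0` shows that equal
measurements give `Q₁(φ, φ)(v) = Q₂(φ, φ)(v)` for every continuous `φ` with `|φ| ≤ 1`
(`SameMeasurements.collision_eq`). This requires, for each `v ≠ 0`, one trajectory that enters and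
leaves transversally; `exists_mem_transversalOutgoing` finds it by a variational argument.

The loss term is then separated from the gain term by raising `ψ` at the single velocity `v`. For `n
≥ 2` almost no collision produces `v` again, so the gain term does not see the change, while the
loss term `ψ(u) ψ(v)` becomes `ψ(u) (ψ(v) + 1/2)`. Approximating by continuous spikes
(`tendsto_collision_add_spike`) shows that `∫∫ B(v, u, ω) ψ(u) dω du` is determined.

Hence `∫∫ (B₁ - B₂)(v, u, ω) ψ(u) dω du = 0` for all admissible `ψ`. In each of the two cases some
`ψ` makes the integrand nonnegative and vanishing only where `B₁ = B₂`; continuity turns this into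
equality everywhere, including `v = 0`. -/

lemma contDiffAt (h : IsDefiningFunction Ω x U ρ) {y : Space n} (hy : y ∈ U) :
    ContDiffAt ℝ ((⊤ : ℕ∞) : WithTop ℕ∞) ρ y :=
  h.smooth.contDiffAt (h.isOpen.mem_nhds hy)

lemma hasGradientAt (h : IsDefiningFunction Ω x U ρ) {y : Space n} (hy : y ∈ U) :
    HasGradientAt ρ (gradient ρ y) y :=
  ((h.contDiffAt hy).differentiableAt (by simp)).hasGradientAt

lemma continuousAt_gradient (h : IsDefiningFunction Ω x U ρ) {y : Space n} (hy : y ∈ U) :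
    ContinuousAt (gradient ρ) y :=
  (InnerProductSpace.toDual ℝ (Space n)).symm.continuous.continuousAt.comp
    ((h.contDiffAt hy).continuousAt_fderiv (by simp))

lemma hasDerivAt_line (h : IsDefiningFunction Ω x U ρ) (v : Space n) {y : Space n} {t : ℝ}
    (hy : y + t • v ∈ U) :
    HasDerivAt (fun s : ℝ => ρ (y + s • v)) (inner ℝ (gradient ρ (y + t • v)) v) t := by
  have h1 : HasDerivAt (fun s : ℝ => y + s • v) v t := by
    simpa using ((hasDerivAt_id t).smul_const v).const_add y
  have h2 := (h.hasGradientAt hy).hasFDerivAt.comp_hasDerivAt t h1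
  have h3 : (InnerProductSpace.toDual ℝ (Space n) (gradient ρ (y + t • v))) v =
      inner ℝ (gradient ρ (y + t • v)) v := InnerProductSpace.toDual_apply_apply
  rw [h3] at h2
  exact h2

lemma eq_zero_of_mem_frontier (h : IsDefiningFunction Ω x U ρ) (hΩ : IsOpen Ω) {y : Space n}
    (hy : y ∈ U) (hyf : y ∈ frontier Ω) : ρ y = 0 := by
  rw [hΩ.frontier_eq] at hyf
  have h0 : 0 ≤ ρ y := not_lt.1 fun hlt => hyf.2 ((h.mem_iff y hy).2 hlt)
  refine le_antisymm (not_lt.1 fun hpos => ?_) h0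
  have hev : ∀ᶠ z in 𝓝 y, z ∈ U ∧ 0 < ρ z :=
    Filter.Eventually.and (h.isOpen.mem_nhds hy) ((h.hasGradientAt hy).continuousAt.eventually_const_lt hpos)
  obtain ⟨z, hz, hzΩ⟩ := (mem_closure_iff_nhds.1 hyf.1) _ hev
  exact absurd ((h.mem_iff z hz.1).1 hzΩ) hz.2.not_gt

lemma eventually_pos_of_inner_pos (h : IsDefiningFunction Ω x U ρ) {y v : Space n}
    (hy : y ∈ U) (hρ : ρ y = 0) (hv : 0 < inner ℝ (gradient ρ y) v) :
    ∀ᶠ t : ℝ in 𝓝[>] 0, y + t • v ∈ U ∧ 0 < ρ (y + t • v) := by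
  have hc : ContinuousAt (fun t : ℝ => y + t • v) 0 := by fun_prop
  have hU : ∀ᶠ t : ℝ in 𝓝[>] 0, y + t • v ∈ U :=
    nhdsWithin_le_nhds (hc.eventually_mem (by simpa using h.isOpen.mem_nhds hy))
  have hd := h.hasDerivAt_line v (y := y) (t := 0) (by simpa using hy)
  have hs := (hasDerivWithinAt_iff_tendsto_slope' (lt_irrefl (0 : ℝ))).1
    (hd.hasDerivWithinAt (s := Ioi 0))
  simp only [zero_smul, add_zero] at hs
  filter_upwards [hU, hs.eventually_const_lt hv, self_mem_nhdsWithin] with t ht hst htpos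
  rw [slope_def_field] at hst
  simp only [zero_smul, add_zero, hρ, sub_zero] at hst
  exact ⟨ht, (div_pos_iff_of_pos_right (show (0 : ℝ) < t from htpos)).1 hst⟩

lemma eventually_mem_of_inner_neg (h : IsDefiningFunction Ω x U ρ) {y v : Space n}
    (hy : y ∈ U) (hρ : ρ y = 0) (hv : inner ℝ (gradient ρ y) v < 0) :
    ∀ᶠ t : ℝ in 𝓝[>] 0, y + t • v ∈ Ω := by
  have hc : ContinuousAt (fun t : ℝ => y + t • v) 0 := by fun_prop
  have hU : ∀ᶠ t : ℝ in 𝓝[>] 0, y + t • v ∈ U :=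
    nhdsWithin_le_nhds (hc.eventually_mem (by simpa using h.isOpen.mem_nhds hy))
  have hd := h.hasDerivAt_line v (y := y) (t := 0) (by simpa using hy)
  have hs := (hasDerivWithinAt_iff_tendsto_slope' (lt_irrefl (0 : ℝ))).1
    (hd.hasDerivWithinAt (s := Ioi 0))
  simp only [zero_smul, add_zero] at hs
  filter_upwards [hU, hs.eventually_lt_const hv, self_mem_nhdsWithin] with t ht hst htpos
  rw [h.mem_iff _ ht]
  have htpos' : (0 : ℝ) < t := htpos
  rw [slope_def_field] at hst
  simp only [zero_smul, add_zero, hρ, sub_zero] at hst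
  exact (div_neg_iff.1 hst).resolve_left (fun h => absurd h.2 htpos'.not_gt) |>.1

lemma congr_point (h : IsDefiningFunction Ω x U ρ) {y : Space n} (hy : y ∈ U) :
    IsDefiningFunction Ω y U ρ :=
  ⟨h.isOpen, hy, h.smooth, h.gradient_ne_zero, h.mem_iff⟩

lemma mem_outgoing (h : IsDefiningFunction Ω x U ρ) {v : Space n} (hx : x ∈ frontier Ω)
    (hv : 0 < inner ℝ (gradient ρ x) v) : (x, v) ∈ outgoing Ω := by
  have hpos : 0 < ‖gradient ρ x‖ := norm_pos_iff.2 (h.gradient_ne_zero x h.mem)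
  refine ⟨hx, ‖gradient ρ x‖⁻¹ • gradient ρ x, ⟨?_, U, ρ, h, ?_⟩, ?_⟩
  · rw [norm_smul, norm_inv, norm_norm, inv_mul_cancel₀ hpos.ne']
  · rw [smul_smul, mul_inv_cancel₀ hpos.ne', one_smul]
  · rw [real_inner_smul_left]
    positivity

end IsDefiningFunction

lemma exists_definingFunction_of_mem_outgoing {p : Space n × Space n} (hp : p ∈ outgoing Ω) :
    p.1 ∈ frontier Ω ∧ ∃ U ρ, IsDefiningFunction Ω p.1 U ρ ∧ 0 < inner ℝ (gradient ρ p.1) p.2 := by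
  obtain ⟨hf, ν, ⟨-, U, ρ, hρ, hg⟩, hν⟩ := hp
  refine ⟨hf, U, ρ, hρ, ?_⟩
  rw [hg, real_inner_smul_left]
  exact mul_pos (norm_pos_iff.2 (hρ.gradient_ne_zero _ hρ.mem)) hν

lemma mem_incoming_iff_neg_mem_outgoing {x v : Space n} :
    (x, v) ∈ incoming Ω ↔ (x, -v) ∈ outgoing Ω := by
  simp [incoming, outgoing]

lemma eventually_sub_mem_of_mem_outgoing (hΩ : IsOpen Ω) {p : Space n × Space n}
    (hp : p ∈ outgoing Ω) : ∀ᶠ t : ℝ in 𝓝[>] 0, p.1 - t • p.2 ∈ Ω := by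
  obtain ⟨hf, U, ρ, h, hv⟩ := exists_definingFunction_of_mem_outgoing hp
  have := h.eventually_mem_of_inner_neg (v := -p.2) h.mem
    (h.eq_zero_of_mem_frontier hΩ h.mem hf) (by simpa using hv)
  simpa [sub_eq_add_neg] using this

/-- The trajectory that starts at `z` with velocity `v` first leaves `Ω` at the time `τ > 0`, through
`Γ₊`. -/
def LeavesAt (Ω : Set (Space n)) (z v : Space n) (τ : ℝ) : Prop :=
  0 < τ ∧ (z + τ • v, v) ∈ outgoing Ω ∧ ∀ s ∈ Ico 0 τ, z + s • v ∈ Ω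

lemma mem_frontier_of_forall_mem (hΩ : IsOpen Ω) {z v : Space n} {τ : ℝ} (hτ : 0 < τ)
    (hmem : ∀ s ∈ Ico 0 τ, z + s • v ∈ Ω) (hout : z + τ • v ∉ Ω) : z + τ • v ∈ frontier Ω := by
  rw [hΩ.frontier_eq]
  refine ⟨?_, hout⟩
  have hc : Continuous fun s : ℝ => z + s • v := by fun_prop
  have h1 : τ ∈ closure (Ico 0 τ) := by
    rw [closure_Ico hτ.ne]; exact ⟨hτ.le, le_rfl⟩
  exact closure_mono (image_subset_iff.2 hmem) (image_closure_subset_closure_image hc ⟨τ, h1, rfl⟩)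

lemma exists_pos_add_smul_notMem (hb : Bornology.IsBounded Ω) (y : Space n) {v : Space n}
    (hv : v ≠ 0) : ∃ D : ℝ, 0 < D ∧ y + D • v ∉ Ω := by
  obtain ⟨R, hR⟩ := hb.exists_norm_le
  have hvn := norm_pos_iff.2 hv
  refine ⟨(|R| + ‖y‖ + 1) / ‖v‖, by positivity, fun hmem => ?_⟩
  have h1 := hR _ hmem
  have h2 : ‖((|R| + ‖y‖ + 1) / ‖v‖) • v‖ = |R| + ‖y‖ + 1 := by
    rw [norm_smul, Real.norm_of_nonneg (by positivity)]
    field_simp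
  have h3 := norm_sub_norm_le (((|R| + ‖y‖ + 1) / ‖v‖) • v) (-y)
  rw [sub_neg_eq_add, add_comm _ y, norm_neg] at h3
  have := le_abs_self R
  linarith

/-- Near every point of `Ω` there is one from which the trajectory with velocity `v` leaves `Ω`
transversally: minimise `τ + C ‖z - y‖²` over the pairs with `z + τ v ∉ Ω`. -/
lemma exists_leavesAt_near (hΩ : IsSmoothBoundedDomain Ω) {y v : Space n} (hv : v ≠ 0) {r : ℝ}
    (hr : 0 < r) (hball : Metric.closedBall y r ⊆ Ω) :
    ∃ z ∈ Metric.ball y r, ∃ τ, LeavesAt Ω z v τ := by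
  obtain ⟨D, hD, hDout⟩ := exists_pos_add_smul_notMem hΩ.isBounded y hv
  -- With `C * r ^ 2 = D + 1 > D`, comparison with the admissible pair `(y, D)` keeps the minimiser
  -- off the boundary sphere of the ball, so `z` can be varied in all directions.
  set C : ℝ := (D + 1) / r ^ 2 with hCdef
  have hC : 0 < C := by positivity
  have hCr : C * r ^ 2 = D + 1 := by rw [hCdef]; field_simp
  set K : Set (Space n × ℝ) :=
    (Metric.closedBall y r ×ˢ Icc 0 D) ∩ {q | q.1 + q.2 • v ∉ Ω} with hK
  have hKc : IsCompact K := by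
    refine ((isCompact_closedBall y r).prod isCompact_Icc).inter_right ?_
    exact hΩ.isOpen.isClosed_compl.preimage (by fun_prop : Continuous fun q : Space n × ℝ =>
      q.1 + q.2 • v)
  have hyK : (y, D) ∈ K := ⟨⟨Metric.mem_closedBall_self hr.le, hD.le, le_rfl⟩, hDout⟩
  obtain ⟨⟨z, τ⟩, hzK, hmin⟩ := hKc.exists_isMinOn ⟨_, hyK⟩
    (f := fun q : Space n × ℝ => q.2 + C * ‖q.1 - y‖ ^ 2) (by fun_prop)
  obtain ⟨⟨hzball, hτ0, hτD⟩, hzout⟩ := hzK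
  simp only at hzball hτ0 hτD
  have hmin' : ∀ w ∈ Metric.closedBall y r, ∀ σ ∈ Icc 0 D, w + σ • v ∉ Ω →
      τ + C * ‖z - y‖ ^ 2 ≤ σ + C * ‖w - y‖ ^ 2 := fun w hw σ hσ hout =>
    hmin (show (w, σ) ∈ K from ⟨⟨hw, hσ⟩, hout⟩)
  have hzin : z ∈ Metric.ball y r := by
    have h1 := hmin' y (Metric.mem_closedBall_self hr.le) D ⟨hD.le, le_rfl⟩ hDout
    simp only [sub_self, norm_zero] at h1
    rw [mem_ball_iff_norm]
    have h2 : C * ‖z - y‖ ^ 2 < C * r ^ 2 := by rw [hCr]; nlinarith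
    exact lt_of_pow_lt_pow_left₀ 2 hr.le (lt_of_mul_lt_mul_left h2 hC.le)
  have hτ : 0 < τ := by
    refine lt_of_le_of_ne hτ0 fun h => hzout ?_
    simpa [← h] using hball hzball
  have hmem : ∀ s ∈ Ico 0 τ, z + s • v ∈ Ω := fun s hs => by
    by_contra hout
    have := hmin' z hzball s ⟨hs.1, hs.2.le.trans hτD⟩ hout
    linarith [hs.2]
  have hfr := mem_frontier_of_forall_mem hΩ.isOpen hτ hmem hzout
  obtain ⟨U, ρ, hρ⟩ := hΩ.smooth_boundary _ hfr
  have hnear : ∀ k : Space n, ∀ᶠ ε : ℝ in 𝓝[>] 0, z + ε • k ∈ Metric.closedBall y r := fun k => by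
    have hc : ContinuousAt (fun t : ℝ => z + t • k) 0 := by fun_prop
    refine nhdsWithin_le_nhds (hc.eventually_mem ?_)
    simpa using mem_of_superset (Metric.isOpen_ball.mem_nhds hzin) Metric.ball_subset_closedBall
  have hexp : ∀ (k : Space n) (ε : ℝ), ‖z + ε • k - y‖ ^ 2 =
      ‖z - y‖ ^ 2 + 2 * ε * inner ℝ (z - y) k + ε ^ 2 * ‖k‖ ^ 2 := fun k ε => by
    rw [add_sub_right_comm, norm_add_sq_real, real_inner_smul_right, norm_smul, mul_pow,
      Real.norm_eq_abs, sq_abs]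
    ring
  -- Compare with `(z + ε v, τ - ε)`, which reaches the same exit point: time drops by `ε`, so the
  -- penalty must grow at least at unit rate.
  have hmv : 0 < inner ℝ (z - y) v := by
    have hlim : ∀ᶠ ε : ℝ in 𝓝[>] 0, C * ε * ‖v‖ ^ 2 < 1 := by
      have hc : ContinuousAt (fun ε : ℝ => C * ε * ‖v‖ ^ 2) 0 := by fun_prop
      exact nhdsWithin_le_nhds (hc.eventually_lt_const (by simp))
    obtain ⟨ε, hε1, hε2, hε3⟩ := ((hnear v).and (hlim.and (Ioo_mem_nhdsGT hτ))).exists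
    have h1 := hmin' _ hε1 (τ - ε) ⟨by linarith [hε3.2], by linarith [hε3.1]⟩ (by
      rwa [add_assoc, ← add_smul, add_sub_cancel])
    rw [hexp] at h1
    have hε0 : (0 : ℝ) < ε := hε3.1
    have h2 : 0 ≤ ε * (2 * C * inner ℝ (z - y) v - (1 - C * ε * ‖v‖ ^ 2)) := by nlinarith
    have h3 := nonneg_of_mul_nonneg_right h2 hε0
    have h4 : 0 < C * inner ℝ (z - y) v := by linarith
    exact (pos_iff_pos_of_mul_pos h4).1 hC
  -- Moving the starting point along such a `k` lowers the penalty, so by minimality the point at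
  -- time `τ` must move into `Ω`.
  have hgrad : ∀ k : Space n, inner ℝ (z - y) k < 0 →
      inner ℝ (gradient ρ (z + τ • v)) k ≤ 0 := fun k hk => by
    have hlim : ∀ᶠ ε : ℝ in 𝓝[>] 0, 2 * inner ℝ (z - y) k + ε * ‖k‖ ^ 2 < 0 := by
      have hc : ContinuousAt (fun ε : ℝ => 2 * inner ℝ (z - y) k + ε * ‖k‖ ^ 2) 0 := by fun_prop
      exact nhdsWithin_le_nhds (hc.eventually_lt_const (by simpa using mul_neg_of_pos_of_neg two_pos hk))
    have hin : ∀ᶠ ε : ℝ in 𝓝[>] 0, z + τ • v + ε • k ∈ Ω := by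
      filter_upwards [hnear k, hlim, self_mem_nhdsWithin] with ε h1 h2 hε
      by_contra hout
      have h3 := hmin' _ h1 τ ⟨hτ0, hτD⟩ (by rwa [add_right_comm])
      rw [hexp] at h3
      have hε0 : (0 : ℝ) < ε := hε
      have h4 : C * (ε * (2 * inner ℝ (z - y) k + ε * ‖k‖ ^ 2)) < 0 :=
        mul_neg_of_pos_of_neg hC (mul_neg_of_pos_of_neg hε0 h2)
      nlinarith
    by_contra! hpos
    obtain ⟨ε, h1, h2, h3⟩ := (hin.and (hρ.eventually_pos_of_inner_pos hρ.mem
      (hρ.eq_zero_of_mem_frontier hΩ.isOpen hρ.mem hfr) hpos)).exists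
    exact absurd ((hρ.mem_iff _ h2).1 h1) h3.not_gt
  refine ⟨z, hzin, τ, hτ, hρ.mem_outgoing hfr ?_, hmem⟩
  by_contra! hneg
  set a := gradient ρ (z + τ • v)
  have ha : 0 < ‖a‖ ^ 2 := by
    have := norm_pos_iff.2 (hρ.gradient_ne_zero _ hρ.mem)
    positivity
  -- If `⟨a, v⟩ ≤ 0`, the direction `a - β v` contradicts `hgrad`: `β` is large enough to make its
  -- product with `z - y` negative, while its product with `a` is at least `‖a‖ ^ 2 > 0`.
  set β : ℝ := (|inner ℝ (z - y) a| + 1) / inner ℝ (z - y) v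
  have hβ : 0 < β := by positivity
  have hβv : β * inner ℝ (z - y) v = |inner ℝ (z - y) a| + 1 := div_mul_cancel₀ _ hmv.ne'
  have h1 := hgrad (a - β • v) (by
    rw [inner_sub_right, real_inner_smul_right, hβv]
    linarith [le_abs_self (inner ℝ (z - y) a)])
  rw [inner_sub_right, real_inner_smul_right, real_inner_self_eq_norm_sq] at h1
  nlinarith

/-- If all `z + s v` with `0 ≤ s ≤ t` lie in the open set `Ω`, the same holds for points near `z`. -/
lemma eventually_forall_add_smul_mem (hΩ : IsOpen Ω) {z v : Space n} {t : ℝ}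
    (h : ∀ s ∈ Icc 0 t, z + s • v ∈ Ω) : ∀ᶠ w in 𝓝 z, ∀ s ∈ Icc 0 t, w + s • v ∈ Ω := by
  refine isCompact_Icc.eventually_forall_of_forall_eventually fun s hs => ?_
  have hc : ContinuousAt (fun q : Space n × ℝ => q.1 + q.2 • v) (z, s) := by fun_prop
  exact hc.eventually_mem (hΩ.mem_nhds (h s hs))

lemma exists_first_exit (hΩ : IsOpen Ω) {z v : Space n} {D : ℝ} (hz : z ∈ Ω) (hD : 0 ≤ D)
    (hout : z + D • v ∉ Ω) :
    ∃ τ, 0 < τ ∧ τ ≤ D ∧ z + τ • v ∉ Ω ∧ ∀ s ∈ Ico 0 τ, z + s • v ∈ Ω := by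
  have hKc : IsCompact (Icc 0 D ∩ {s : ℝ | z + s • v ∉ Ω}) :=
    isCompact_Icc.inter_right (hΩ.isClosed_compl.preimage (by fun_prop : Continuous fun s : ℝ =>
      z + s • v))
  obtain ⟨τ, hτ, hmin⟩ := hKc.exists_isLeast ⟨D, ⟨hD, le_rfl⟩, hout⟩
  refine ⟨τ, lt_of_le_of_ne hτ.1.1 fun h => hτ.2 (by simpa [← h] using hz), hτ.1.2, hτ.2,
    fun s hs => ?_⟩
  by_contra hs'
  exact absurd (hmin ⟨⟨hs.1, hs.2.le.trans hτ.1.2⟩, hs'⟩) hs.2.not_ge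

/-- Transversality is an open condition. Nearby trajectories are still inside at time `τ - t` and
already outside at time `τ + t`; in between they stay in a neighbourhood `N` of the exit point where
the defining function increases along `v`, so their first exit is again through `Γ₊`. -/
lemma LeavesAt.eventually (hΩ : IsOpen Ω) {z v : Space n} {τ : ℝ} (h : LeavesAt Ω z v τ) :
    ∀ᶠ w in 𝓝 z, ∃ σ, LeavesAt Ω w v σ := by
  obtain ⟨hτ, hout, hmem⟩ := h
  obtain ⟨hfr, U, ρ, hρ, hpos⟩ := exists_definingFunction_of_mem_outgoing hout
  simp only at hfr hpos hρ
  set N : Set (Space n) := {y | y ∈ U ∧ 0 < inner ℝ (gradient ρ y) v}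
  have hN : N ∈ 𝓝 (z + τ • v) := by
    refine Filter.Eventually.and (hρ.isOpen.mem_nhds hρ.mem) ?_
    exact ((hρ.continuousAt_gradient hρ.mem).inner continuousAt_const).eventually_const_lt hpos
  have hc : Continuous fun q : Space n × ℝ => q.1 + q.2 • v := by fun_prop
  have hNN : ∀ᶠ q in 𝓝 (z, τ), q.1 + q.2 • v ∈ N := hc.continuousAt.eventually_mem hN
  rw [nhds_prod_eq] at hNN
  obtain ⟨P, hP, R, hR, hPR⟩ := eventually_prod_iff.1 hNN
  obtain ⟨η, hη, hηR⟩ := Metric.eventually_nhds_iff.1 hR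
  have hpast := hρ.eventually_pos_of_inner_pos hρ.mem (hρ.eq_zero_of_mem_frontier hΩ hρ.mem hfr) hpos
  obtain ⟨t, ⟨-, ht1⟩, ht0, ht2⟩ := (hpast.and
    (Ioo_mem_nhdsGT (lt_min hτ hη) : Ioo 0 (min τ η) ∈ 𝓝[>] 0)).exists
  have htτ : t < τ := ht2.trans_le (min_le_left _ _)
  have htη : t < η := ht2.trans_le (min_le_right _ _)
  have hend : z + (τ + t) • v ∈ U :=
    (hPR hP.self_of_nhds (hηR (by simpa [Real.dist_eq, abs_of_pos ht0] using htη))).1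
  have hfar : ∀ᶠ w in 𝓝 z, 0 < ρ (w + (τ + t) • v) := by
    have h1 : ContinuousAt ρ (z + (τ + t) • v) := (hρ.hasGradientAt hend).continuousAt
    have h2 : ContinuousAt (fun w : Space n => w + (τ + t) • v) z := by fun_prop
    have h3 : ContinuousAt (fun w => ρ (w + (τ + t) • v)) z := ContinuousAt.comp (g := ρ) h1 h2
    exact h3.eventually_const_lt (by simpa only [add_smul, ← add_assoc] using ht1)
  have hseg := eventually_forall_add_smul_mem hΩ (t := τ - t) fun s hs =>
    hmem s ⟨hs.1, by linarith [hs.2]⟩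
  filter_upwards [hfar, hseg, hP] with w hw1 hw2 hw3
  have hR' : ∀ s ∈ Icc (τ - t) (τ + t), w + s • v ∈ N := fun s hs => by
    refine hPR hw3 (hηR ?_)
    rw [Real.dist_eq]
    exact (abs_sub_le_iff.2 ⟨by linarith [hs.2], by linarith [hs.1]⟩).trans_lt htη
  have hwout : w + (τ + t) • v ∉ Ω := fun hin =>
    absurd ((hρ.mem_iff _ (hR' _ ⟨by linarith, le_rfl⟩).1).1 hin) hw1.not_gt
  have hwin : w ∈ Ω := by simpa using hw2 0 ⟨le_rfl, by linarith⟩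
  obtain ⟨σ, hσ0, hσ1, hσ2, hσ3⟩ := exists_first_exit hΩ hwin (by linarith) hwout
  have hσ4 : τ - t ≤ σ := by
    by_contra! hlt
    exact hσ2 (hw2 σ ⟨hσ0.le, hlt.le⟩)
  have hσN := hR' σ ⟨hσ4, hσ1⟩
  exact ⟨σ, hσ0, (hρ.congr_point hσN.1).mem_outgoing
    (mem_frontier_of_forall_mem hΩ hσ0 hσ3 hσ2) hσN.2, hσ3⟩

/-- For every `v ≠ 0` some trajectory with velocity `v` enters `Ω` through `Γ₋` and leaves it
through `Γ₊`. -/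
theorem exists_mem_transversalOutgoing (hΩ : IsSmoothBoundedDomain Ω) {v : Space n} (hv : v ≠ 0) :
    ∃ x, (x, v) ∈ transversalOutgoing Ω := by
  obtain ⟨y, hy⟩ := hΩ.isConnected.nonempty
  obtain ⟨r, hr, hball⟩ := Metric.nhds_basis_closedBall.mem_iff.1 (hΩ.isOpen.mem_nhds hy)
  -- Arrange the forward exit first. It persists on a ball around `z`, and inside that ball the
  -- starting point is moved again to make the backward exit transversal.
  obtain ⟨z, hz, τ, hτ⟩ := exists_leavesAt_near hΩ hv hr hball
  have hzΩ : z ∈ Ω := hball (Metric.ball_subset_closedBall hz)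
  obtain ⟨r', hr', hball'⟩ := Metric.nhds_basis_closedBall.mem_iff.1
    ((hτ.eventually hΩ.isOpen).and (hΩ.isOpen.mem_nhds hzΩ))
  obtain ⟨w, hw, σ, hσ0, hσ1, hσ2⟩ := exists_leavesAt_near hΩ (neg_ne_zero.2 hv) hr'
    fun q hq => (hball' hq).2
  obtain ⟨κ, hκ0, hκ1, hκ2⟩ := (hball' (Metric.ball_subset_closedBall hw)).1
  refine ⟨w + κ • v, hκ1, κ + σ, by positivity, ?_, fun s hs => ?_⟩
  · rw [mem_incoming_iff_neg_mem_outgoing]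
    convert hσ1 using 2
    simp only
    module
  · simp only
    rcases le_total s κ with h | h
    · convert hκ2 (κ - s) ⟨by linarith, by linarith [hs.1]⟩ using 1
      module
    · convert hσ2 (s - κ) ⟨by linarith, by linarith [hs.2]⟩ using 1
      module

/-! ### Estimates for the collision operator -/

instance : IsFiniteMeasure (sphereMeasure n) := by unfold sphereMeasure; infer_instance

instance : (sphereMeasure n).IsOpenPosMeasure := by unfold sphereMeasure; infer_instance

/-- The product `du dω` of Lebesgue measure and the surface measure. -/
noncomputable abbrev collisionMeasure (n : ℕ) : Measure (Space n × USphere n) :=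
  (volume : Measure (Space n)).prod (sphereMeasure n)

lemma continuous_uPrime :
    Continuous fun p : Space n × Space n × USphere n => uPrime p.1 p.2.1 p.2.2 := by
  unfold uPrime; fun_prop

lemma continuous_vPrime :
    Continuous fun p : Space n × Space n × USphere n => vPrime p.1 p.2.1 p.2.2 := by
  unfold vPrime; fun_prop

lemma measurable_uPrime (v : Space n) :
    Measurable fun q : Space n × USphere n => uPrime v q.1 q.2 :=
  (continuous_uPrime.comp (Continuous.prodMk_right v)).measurable

lemma measurable_vPrime (v : Space n) :
    Measurable fun q : Space n × USphere n => vPrime v q.1 q.2 :=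
  (continuous_vPrime.comp (Continuous.prodMk_right v)).measurable

/-- The difference of products of values of `H` in the collision integral. -/
noncomputable def collisionBracket (H : Space n → ℝ) (v : Space n) (q : Space n × USphere n) : ℝ :=
  H (uPrime v q.1 q.2) * H (vPrime v q.1 q.2) - H q.1 * H v

lemma measurable_collisionBracket {H : Space n → ℝ} (hH : Measurable H) (v : Space n) :
    Measurable (collisionBracket H v) :=
  ((hH.comp (measurable_uPrime v)).mul (hH.comp (measurable_vPrime v))).sub
    ((hH.comp measurable_fst).mul_const _)

lemma abs_mul_sub_mul_le {a a' b b' r d : ℝ} (ha : |a| ≤ r) (hb' : |b'| ≤ r) (hab : |a - b| ≤ d)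
    (hab' : |a' - b'| ≤ d) : |a * a' - b * b'| ≤ 2 * r * d := by
  have h : a * a' - b * b' = a * (a' - b') + (a - b) * b' := by ring
  rw [h]
  refine (abs_add_le _ _).trans ?_
  rw [abs_mul, abs_mul]
  have h1 : |a| * |a' - b'| ≤ r * d :=
    mul_le_mul ha hab' (abs_nonneg _) ((abs_nonneg _).trans ha)
  have h2 : |a - b| * |b'| ≤ d * r :=
    mul_le_mul hab hb' (abs_nonneg _) ((abs_nonneg _).trans hab)
  linarith

/-- The bracket is a difference of two products, and each product of functions bounded by `r` varies
by at most `2 * r * d`. -/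
lemma abs_collisionBracket_sub_le {H K : Space n → ℝ} {r d : ℝ} (hH : ∀ w, |H w| ≤ r)
    (hK : ∀ w, |K w| ≤ r) (hHK : ∀ w, |H w - K w| ≤ d) (v : Space n) (q : Space n × USphere n) :
    |collisionBracket H v q - collisionBracket K v q| ≤ 4 * r * d := by
  have h1 := abs_mul_sub_mul_le (hH (uPrime v q.1 q.2)) (hK (vPrime v q.1 q.2))
    (hHK (uPrime v q.1 q.2)) (hHK (vPrime v q.1 q.2))
  have h2 := abs_mul_sub_mul_le (hH q.1) (hK v) (hHK q.1) (hHK v)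
  have h3 : collisionBracket H v q - collisionBracket K v q =
      (H (uPrime v q.1 q.2) * H (vPrime v q.1 q.2) - K (uPrime v q.1 q.2) * K (vPrime v q.1 q.2)) -
        (H q.1 * H v - K q.1 * K v) := by
    unfold collisionBracket; ring
  rw [h3]
  refine (abs_sub _ _).trans ?_
  linarith

lemma abs_collisionBracket_le {H : Space n → ℝ} {r : ℝ} (hH : ∀ w, |H w| ≤ r) (v : Space n)
    (q : Space n × USphere n) : |collisionBracket H v q| ≤ 4 * r * r := by
  have hr : 0 ≤ r := (abs_nonneg _).trans (hH 0)
  simpa [collisionBracket] using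
    abs_collisionBracket_sub_le (K := fun _ => 0) hH (by simpa using hr) (by simpa using hH) v q

section Kernel

variable {B : Kernel n}

lemma IsContinuousKernel.continuous_fixed (hB : IsContinuousKernel B) (v : Space n) :
    Continuous fun q : Space n × USphere n => B v q.1 q.2 :=
  hB.comp (Continuous.prodMk_right v)

lemma lintegral_enorm_kernel (hB : IsContinuousKernel B) (v : Space n) :
    ∫⁻ q, ‖B v q.1 q.2‖ₑ ∂(collisionMeasure n) = kernelMass B v :=
  lintegral_prod _ (hB.continuous_fixed v).measurable.enorm.aemeasurable

lemma integrable_kernel (hB : IsContinuousKernel B) {v : Space n} (hm : kernelMass B v ≠ ∞) :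
    Integrable (fun q : Space n × USphere n => B v q.1 q.2) (collisionMeasure n) :=
  ⟨(hB.continuous_fixed v).measurable.aestronglyMeasurable, by
    rw [hasFiniteIntegral_iff_enorm, lintegral_enorm_kernel hB]; exact hm.lt_top⟩

lemma integral_norm_kernel (hB : IsContinuousKernel B) (v : Space n) :
    ∫ q, ‖B v q.1 q.2‖ ∂(collisionMeasure n) = (kernelMass B v).toReal := by
  rw [integral_norm_eq_lintegral_enorm (hB.continuous_fixed v).measurable.aestronglyMeasurable,
    lintegral_enorm_kernel hB]

lemma integrable_kernel_mul_bracket (hB : IsContinuousKernel B) {v : Space n}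
    (hm : kernelMass B v ≠ ∞) {H : Space n → ℝ} (hH : Measurable H) {r : ℝ}
    (hr : ∀ w, |H w| ≤ r) :
    Integrable (fun q : Space n × USphere n => B v q.1 q.2 * collisionBracket H v q)
      (collisionMeasure n) :=
  (integrable_kernel hB hm).mul_bdd
    (measurable_collisionBracket hH v).aestronglyMeasurable
    (Eventually.of_forall fun q => abs_collisionBracket_le hr v q)

lemma collision_eq_integral (hB : IsContinuousKernel B) {v : Space n}
    (hm : kernelMass B v ≠ ∞) {F : Space n → Space n → ℝ} {x : Space n} (hF : Measurable (F x))
    {r : ℝ} (hr : ∀ w, |F x w| ≤ r) :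
    collision B F F x v =
      ∫ q, B v q.1 q.2 * collisionBracket (F x) v q ∂(collisionMeasure n) :=
  (integral_prod _ (integrable_kernel_mul_bracket hB hm hF hr)).symm

lemma abs_collision_sub_le (hB : IsContinuousKernel B) {v : Space n}
    (hm : kernelMass B v ≠ ∞) {F K : Space n → Space n → ℝ} {x : Space n}
    (hF : Measurable (F x)) (hK : Measurable (K x)) {r d : ℝ} (hFr : ∀ w, |F x w| ≤ r)
    (hKr : ∀ w, |K x w| ≤ r) (hFK : ∀ w, |F x w - K x w| ≤ d) :
    |collision B F F x v - collision B K K x v| ≤ 4 * r * d * (kernelMass B v).toReal := by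
  rw [collision_eq_integral hB hm hF hFr, collision_eq_integral hB hm hK hKr,
    ← integral_sub (integrable_kernel_mul_bracket hB hm hF hFr)
      (integrable_kernel_mul_bracket hB hm hK hKr), ← integral_norm_kernel hB,
    ← integral_const_mul]
  rw [← Real.norm_eq_abs]
  refine norm_integral_le_of_norm_le ((integrable_kernel hB hm).norm.const_mul _)
    (Eventually.of_forall fun q => ?_)
  rw [← mul_sub, norm_mul, mul_comm]
  exact mul_le_mul_of_nonneg_right (abs_collisionBracket_sub_le hFr hKr hFK v q) (norm_nonneg _)

lemma abs_collision_le (hB : IsContinuousKernel B) {v : Space n}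
    (hm : kernelMass B v ≠ ∞) {F : Space n → Space n → ℝ} {x : Space n}
    (hF : Measurable (F x)) {r : ℝ} (hFr : ∀ w, |F x w| ≤ r) :
    |collision B F F x v| ≤ 4 * r * r * (kernelMass B v).toReal := by
  have hr : 0 ≤ r := (abs_nonneg _).trans (hFr 0)
  simpa [collision] using abs_collision_sub_le (K := fun _ _ => 0) hB hm hF measurable_const hFr
    (by simpa using hr) (by simpa using hFr)

lemma measurable_collision (hB : IsContinuousKernel B) {F : Space n → Space n → ℝ}
    (hF : Measurable (Function.uncurry F)) :
    Measurable fun p : Space n × Space n => collision B F F p.1 p.2 := by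
  have hF' : ∀ {α : Type} [MeasurableSpace α] {f g : α → Space n}, Measurable f → Measurable g →
      Measurable fun a => F (f a) (g a) := fun hf hg => hF.comp (hf.prodMk hg)
  have hx : Measurable fun a : ((Space n × Space n) × Space n) × USphere n => a.1.1.1 := by fun_prop
  have hv : Measurable fun a : ((Space n × Space n) × Space n) × USphere n => a.1.1.2 := by fun_prop
  have hu : Measurable fun a : ((Space n × Space n) × Space n) × USphere n => a.1.2 := by fun_prop
  have hω : Measurable fun a : ((Space n × Space n) × Space n) × USphere n => a.2 := by fun_prop
  have hBm : Measurable fun a : ((Space n × Space n) × Space n) × USphere n =>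
      B a.1.1.2 a.1.2 a.2 := hB.measurable.comp (hv.prodMk (hu.prodMk hω))
  have hu' : Measurable fun a : ((Space n × Space n) × Space n) × USphere n =>
      uPrime a.1.1.2 a.1.2 a.2 := continuous_uPrime.measurable.comp (hv.prodMk (hu.prodMk hω))
  have hv' : Measurable fun a : ((Space n × Space n) × Space n) × USphere n =>
      vPrime a.1.1.2 a.1.2 a.2 := continuous_vPrime.measurable.comp (hv.prodMk (hu.prodMk hω))
  have h := hBm.mul (((hF' hx hu').mul (hF' hx hv')).sub ((hF' hx hu).mul (hF' hx hv)))
  have h1 := h.stronglyMeasurable.integral_prod_right' (ν := sphereMeasure n)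
  exact (h1.integral_prod_right' (ν := (volume : Measure (Space n)))).measurable

end Kernel

/-! ### The time spent in the domain -/

/-- The times `s > 0` such that `x - r v ∈ Ω` for all `0 ≤ r ≤ s`; none for `v = 0`. -/
def backwardTimes (Ω : Set (Space n)) (x v : Space n) : Set ℝ :=
  {s | v ≠ 0 ∧ 0 < s ∧ ∀ r ∈ Icc 0 s, x - r • v ∈ Ω}

lemma isOpen_setOf_mem_backwardTimes (hΩ : IsOpen Ω) :
    IsOpen {q : (Space n × Space n) × ℝ | q.2 ∈ backwardTimes Ω q.1.1 q.1.2} := by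
  -- Rescaling `r` by the time makes the parameter interval `[0, 1]` fixed and compact, so the tube
  -- lemma applies.
  have h3 : IsOpen {q : (Space n × Space n) × ℝ |
      ∀ r ∈ Icc (0 : ℝ) 1, q.1.1 - (r * q.2) • q.1.2 ∈ Ω} := by
    rw [isOpen_iff_mem_nhds]
    intro q hq
    refine isCompact_Icc.eventually_forall_of_forall_eventually fun r hr => ?_
    have hc : ContinuousAt (fun a : ((Space n × Space n) × ℝ) × ℝ =>
      a.1.1.1 - (a.2 * a.1.2) • a.1.1.2) (q, r) := by fun_prop
    exact hc.eventually_mem (hΩ.mem_nhds (hq r hr))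
  have h1 : IsOpen {q : (Space n × Space n) × ℝ | q.1.2 ≠ 0} :=
    isOpen_ne.preimage (by fun_prop : Continuous fun q : (Space n × Space n) × ℝ => q.1.2)
  have h2 : IsOpen {q : (Space n × Space n) × ℝ | 0 < q.2} := isOpen_Ioi.preimage continuous_snd
  convert h1.inter (h2.inter h3) using 1
  ext q
  simp only [backwardTimes, mem_ofPred_eq, mem_inter_iff]
  refine and_congr_right fun _ => and_congr_right fun hpos => ⟨fun h r hr => ?_, fun h r hr => ?_⟩
  · exact h _ ⟨by nlinarith [hr.1], by nlinarith [hr.2]⟩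
  · have := h (r / q.2) ⟨div_nonneg hr.1 hpos.le, (div_le_one hpos).2 hr.2⟩
    rwa [div_mul_cancel₀ _ hpos.ne'] at this

lemma measurableSet_backwardTimes (hΩ : IsOpen Ω) (x v : Space n) :
    MeasurableSet (backwardTimes Ω x v) :=
  ((isOpen_setOf_mem_backwardTimes hΩ).preimage (Continuous.prodMk_right (x, v))).measurableSet

lemma backwardTimes_zero (x : Space n) : backwardTimes Ω x 0 = ∅ := by simp [backwardTimes]

lemma volume_backwardTimes_ne_top (hb : Bornology.IsBounded Ω) (x v : Space n) :
    volume (backwardTimes Ω x v) ≠ ∞ := by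
  by_cases hv : v = 0
  · simp [hv, backwardTimes_zero]
  obtain ⟨D, hD, hout⟩ := exists_pos_add_smul_notMem hb x (neg_ne_zero.2 hv)
  have hsub : backwardTimes Ω x v ⊆ Icc 0 D := fun s hs => by
    refine ⟨hs.2.1.le, not_lt.1 fun hlt => hout ?_⟩
    simpa [sub_eq_add_neg] using hs.2.2 D ⟨hD.le, hlt.le⟩
  exact ((measure_mono hsub).trans_lt isCompact_Icc.measure_lt_top).ne

/-- Only an inequality: in a non-convex domain `tauMinus` also sees earlier passages of the line
through `Ω`. -/
lemma volume_backwardTimes_le_tauMinus (x v : Space n) :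
    volume (backwardTimes Ω x v) ≤ tauMinus Ω x v := by
  have hle : ∀ s ∈ backwardTimes Ω x v, ENNReal.ofReal s ≤ tauMinus Ω x v := fun s hs =>
    le_iSup₂_of_le s ⟨hs.2.1.le, hs.2.2 s ⟨hs.2.1.le, le_rfl⟩⟩ le_rfl
  by_cases htop : tauMinus Ω x v = ∞
  · rw [htop]; exact le_top
  have hsub : backwardTimes Ω x v ⊆ Ioc 0 (tauMinus Ω x v).toReal := fun s hs =>
    ⟨hs.2.1, (ENNReal.ofReal_le_iff_le_toReal htop).1 (hle s hs)⟩
  refine (measure_mono hsub).trans ?_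
  rw [Real.volume_Ioc, sub_zero, ENNReal.ofReal_toReal htop]

/-- The bound on the kernel in the form used below: total collision mass along trajectories in `Ω`,
counted up to the time of entrance. -/
structure MassBound (Ω : Set (Space n)) (B : Kernel n) (M : ℝ) : Prop where
  pos : 0 < M
  ne_top : ∀ v, v ≠ 0 → kernelMass B v ≠ ∞
  le : ∀ x v, v ≠ 0 → volume.real (backwardTimes Ω x v) * (kernelMass B v).toReal ≤ M

lemma KernelBound.exists_massBound (hΩ : IsOpen Ω) (hne : Ω.Nonempty) {B : Kernel n}
    (h : KernelBound Ω B) : ∃ M, MassBound Ω B M := by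
  obtain ⟨M, hM, hb⟩ := h
  refine ⟨M, hM, fun v hv htop => ?_, fun x v hv => ?_⟩
  -- At a point of the open set `Ω` the exit time is positive, so an infinite mass would make the
  -- product infinite.
  · obtain ⟨x, hx⟩ := hne
    have hc : ContinuousAt (fun s : ℝ => x - s • v) 0 := by fun_prop
    have hev : ∀ᶠ s : ℝ in 𝓝[>] 0, x - s • v ∈ Ω :=
      nhdsWithin_le_nhds (hc.eventually_mem (by simpa using hΩ.mem_nhds hx))
    obtain ⟨s, hs, hpos⟩ := (hev.and self_mem_nhdsWithin).exists
    have hτ : tauMinus Ω x v ≠ 0 := by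
      have h1 : ENNReal.ofReal s ≤ tauMinus Ω x v :=
        le_iSup₂_of_le s ⟨(show (0 : ℝ) < s from hpos).le, hs⟩ le_rfl
      exact ((ENNReal.ofReal_pos.2 hpos).trans_le h1).ne'
    have h2 := (hb x (subset_closure hx) v hv).2
    rw [htop, ENNReal.mul_top hτ] at h2
    exact not_top_lt h2
  · by_cases hx : x ∈ Ω
    · have h2 := (mul_le_mul_left (volume_backwardTimes_le_tauMinus (Ω := Ω) x v)
        (kernelMass B v)).trans (hb x (subset_closure hx) v hv).2.le
      rw [measureReal_def, ← ENNReal.toReal_mul]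
      exact ENNReal.toReal_le_of_le_ofReal hM.le h2
    · have : backwardTimes Ω x v = ∅ := eq_empty_of_forall_notMem fun s hs =>
        hx (by simpa using hs.2.2 0 ⟨le_rfl, hs.2.1.le⟩)
      simp [this, hM.le]

/-- The integral along the past of `x + t v` splits into the piece between `x` and `x + t v` and the
past of `x`. This is what turns a fixed point of `duhamel` into a solution of the transport
equation. -/
lemma setIntegral_backwardTimes_add {x v : Space n} (hΩ : IsOpen Ω) (hv : v ≠ 0) {t : ℝ}
    (ht : 0 ≤ t) (hseg : ∀ s ∈ Icc 0 t, x + s • v ∈ Ω) {f : Space n → ℝ}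
    (hf : IntegrableOn (fun s : ℝ => f (x + t • v - s • v)) (backwardTimes Ω (x + t • v) v)) :
    ∫ s in backwardTimes Ω (x + t • v) v, f (x + t • v - s • v) =
      (∫ s in (0 : ℝ)..t, f (x + s • v)) + ∫ s in backwardTimes Ω x v, f (x - s • v) := by
  have hset : backwardTimes Ω (x + t • v) v = Ioc 0 t ∪ (fun s => s - t) ⁻¹' backwardTimes Ω x v := by
    ext s
    constructor
    · intro hs
      rcases le_or_gt s t with h | h
      · exact Or.inl ⟨hs.2.1, h⟩
      · refine Or.inr ⟨hv, sub_pos.2 h, fun r hr => ?_⟩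
        convert hs.2.2 (r + t) ⟨by linarith [hr.1], by linarith [hr.2]⟩ using 1
        module
    · rintro (hs | hs)
      · refine ⟨hv, hs.1, fun r hr => ?_⟩
        convert hseg (t - r) ⟨by linarith [hr.2, hs.2], by linarith [hr.1]⟩ using 1
        module
      · refine ⟨hv, by linarith [hs.2.1], fun r hr => ?_⟩
        rcases le_or_gt r t with h | h
        · convert hseg (t - r) ⟨by linarith, by linarith [hr.1]⟩ using 1
          module
        · convert hs.2.2 (r - t) ⟨by linarith, by linarith [hr.2]⟩ using 1
          module
  have hdisj : Disjoint (Ioc 0 t) ((fun s => s - t) ⁻¹' backwardTimes Ω x v) :=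
    disjoint_left.2 fun s hs hs' => by have := hs'.2.1; linarith [hs.2]
  have hmeas := (measurableSet_backwardTimes hΩ x v).preimage (measurable_id.sub_const t)
  rw [hset] at hf ⊢
  rw [setIntegral_union hdisj hmeas (hf.mono_set subset_union_left)
    (hf.mono_set subset_union_right)]
  congr 1
  · rw [← intervalIntegral.integral_of_le ht]
    have h1 := intervalIntegral.integral_comp_sub_left (fun s : ℝ => f (x + s • v)) t (a := 0)
      (b := t)
    rw [sub_self, sub_zero] at h1
    rw [← h1]
    refine intervalIntegral.integral_congr fun s _ => congrArg f ?_
    module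
  · rw [← (measurePreserving_sub_right volume t).setIntegral_preimage_emb
      (MeasurableEquiv.subRight t).measurableEmbedding (fun s => f (x - s • v))]
    refine setIntegral_congr_fun hmeas fun s _ => congrArg f ?_
    module

/-- The times spent in `Ω` since the entrance, at the time `t` before the exit. -/
lemma backwardTimes_eq_Ioo {x v : Space n} (hv : v ≠ 0) {T t : ℝ} (ht : 0 < t)
    (hmem : ∀ s ∈ Ioo 0 T, x - s • v ∈ Ω) (hout : x - T • v ∉ Ω) (htT : t < T) :
    backwardTimes Ω (x - t • v) v = Ioo 0 (T - t) := by
  ext s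
  constructor
  · intro hs
    refine ⟨hs.2.1, not_le.1 fun hle => hout ?_⟩
    convert hs.2.2 (T - t) ⟨by linarith, hle⟩ using 1
    module
  · intro hs
    refine ⟨hv, hs.1, fun r hr => ?_⟩
    convert hmem (t + r) ⟨by linarith [hr.1], by linarith [hr.2, hs.2]⟩ using 1
    module

/-! ### Solutions with small data that depend on the velocity only -/

/-- The right-hand side of the integrated equation with incoming datum `φ(v)`. -/
noncomputable def duhamel (Ω : Set (Space n)) (B : Kernel n) (φ : Space n → ℝ)
    (F : Space n → Space n → ℝ) (x v : Space n) : ℝ :=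
  φ v + ∫ s in backwardTimes Ω x v, collision B F F (x - s • v) v

section Duhamel

variable {B : Kernel n} {M : ℝ} {φ : Space n → ℝ}

lemma measurable_uncurry_duhamel (hΩ : IsOpen Ω) (hB : IsContinuousKernel B) (hφ : Measurable φ)
    {F : Space n → Space n → ℝ} (hF : Measurable (Function.uncurry F)) :
    Measurable (Function.uncurry (duhamel Ω B φ F)) := by
  have hA := (isOpen_setOf_mem_backwardTimes hΩ).measurableSet
  have hq : Measurable fun q : (Space n × Space n) × ℝ =>
      collision B F F (q.1.1 - q.2 • q.1.2) q.1.2 :=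
    (measurable_collision hB hF).comp
      (by fun_prop : Measurable fun q : (Space n × Space n) × ℝ => (q.1.1 - q.2 • q.1.2, q.1.2))
  have h := (hq.indicator hA).stronglyMeasurable.integral_prod_right'
    (ν := (volume : Measure ℝ))
  -- The domain of integration varies with `(x, v)`; as an indicator of one jointly open set it
  -- yields joint measurability.
  have heq : Function.uncurry (duhamel Ω B φ F) = fun p => φ p.2 + ∫ s : ℝ,
      {q : (Space n × Space n) × ℝ | q.2 ∈ backwardTimes Ω q.1.1 q.1.2}.indicator
        (fun q => collision B F F (q.1.1 - q.2 • q.1.2) q.1.2) (p, s) := by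
    ext p
    simp only [Function.uncurry, duhamel, ← integral_indicator (measurableSet_backwardTimes hΩ _ _)]
    rfl
  rw [heq]
  exact (hφ.comp measurable_snd).add h.measurable

lemma integrableOn_collision (hΩ : IsSmoothBoundedDomain Ω) (hB : IsContinuousKernel B)
    (hM : MassBound Ω B M) {F : Space n → Space n → ℝ} (hF : Measurable (Function.uncurry F))
    {r : ℝ} (hFr : ∀ x w, |F x w| ≤ r) (x v : Space n) :
    IntegrableOn (fun s : ℝ => collision B F F (x - s • v) v) (backwardTimes Ω x v) := by
  by_cases hv : v = 0
  · simp [hv, backwardTimes_zero]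
  refine Measure.integrableOn_of_bounded (M := 4 * r * r * (kernelMass B v).toReal)
    (volume_backwardTimes_ne_top hΩ.isBounded x v) ?_ (Eventually.of_forall fun s => ?_)
  · exact ((measurable_collision hB hF).comp (by fun_prop :
      Measurable fun s : ℝ => (x - s • v, v))).aestronglyMeasurable
  · exact abs_collision_le hB (hM.ne_top v hv) hF.of_uncurry_left (hFr _)

/-- The contraction estimate: the bound on the bracket times the kernel mass, integrated over the
time spent in `Ω`, which together contribute at most `M`. -/
lemma abs_duhamel_sub_le (hΩ : IsSmoothBoundedDomain Ω) (hB : IsContinuousKernel B)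
    (hM : MassBound Ω B M) {F K : Space n → Space n → ℝ} (hF : Measurable (Function.uncurry F))
    (hK : Measurable (Function.uncurry K)) {r d : ℝ} (hFr : ∀ x w, |F x w| ≤ r)
    (hKr : ∀ x w, |K x w| ≤ r) (hFK : ∀ x w, |F x w - K x w| ≤ d) (x v : Space n) :
    |duhamel Ω B φ F x v - duhamel Ω B φ K x v| ≤ 4 * r * d * M := by
  have hr : 0 ≤ r := (abs_nonneg _).trans (hFr 0 0)
  have hd : 0 ≤ d := (abs_nonneg _).trans (hFK 0 0)
  have hM0 := hM.pos
  unfold duhamel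
  rw [add_sub_add_left_eq_sub, ← integral_sub (integrableOn_collision hΩ hB hM hF hFr x v)
    (integrableOn_collision hΩ hB hM hK hKr x v)]
  by_cases hv : v = 0
  · simp only [hv, backwardTimes_zero, Measure.restrict_empty, integral_zero_measure, abs_zero]
    positivity
  rw [← Real.norm_eq_abs]
  refine (norm_setIntegral_le_of_norm_le_const
    (volume_backwardTimes_ne_top hΩ.isBounded x v).lt_top fun s _ =>
      abs_collision_sub_le hB (hM.ne_top v hv) hF.of_uncurry_left hK.of_uncurry_left
        (hFr _) (hKr _) (hFK _)).trans ?_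
  have := mul_le_mul_of_nonneg_left (hM.le x v hv) (by positivity : 0 ≤ 4 * r * d)
  linarith

lemma duhamel_zero (x v : Space n) : duhamel Ω B φ (fun _ _ => 0) x v = φ v := by
  simp [duhamel, collision]

lemma abs_duhamel_sub_datum_le (hΩ : IsSmoothBoundedDomain Ω) (hB : IsContinuousKernel B)
    (hM : MassBound Ω B M) {F : Space n → Space n → ℝ} (hF : Measurable (Function.uncurry F))
    {r : ℝ} (hFr : ∀ x w, |F x w| ≤ r) (x v : Space n) :
    |duhamel Ω B φ F x v - φ v| ≤ 4 * r * r * M := by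
  have hr : 0 ≤ r := (abs_nonneg _).trans (hFr 0 0)
  simpa [duhamel_zero] using abs_duhamel_sub_le (φ := φ) hΩ hB hM hF (K := fun _ _ => 0)
    measurable_const hFr (by simpa using hr) (by simpa using hFr) x v

/-- A datum of size `l ≤ 1 / (16 M)` has a solution of size `2 l`. -/
theorem exists_eq_duhamel (hΩ : IsSmoothBoundedDomain Ω) (hB : IsContinuousKernel B)
    (hM : MassBound Ω B M) (hφ : Measurable φ) {l : ℝ} (hφl : ∀ w, |φ w| ≤ l)
    (hl : 16 * M * l ≤ 1) :
    ∃ F : Space n → Space n → ℝ, Measurable (Function.uncurry F) ∧ (∀ x v, |F x v| ≤ 2 * l) ∧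
      ∀ x v, F x v = duhamel Ω B φ F x v := by
  have hl0 : 0 ≤ l := (abs_nonneg _).trans (hφl 0)
  have hM0 := hM.pos
  let f : ℕ → Space n → Space n → ℝ := fun k => (duhamel Ω B φ)^[k] fun _ _ => 0
  have hsucc : ∀ k, f (k + 1) = duhamel Ω B φ (f k) := fun k => Function.iterate_succ_apply' _ _ _
  have hmeas : ∀ k, Measurable (Function.uncurry (f k)) := fun k => by
    induction k with
    | zero => exact measurable_const
    | succ k ih => rw [hsucc]; exact measurable_uncurry_duhamel hΩ.isOpen hB hφ ih
  -- On the ball of radius `2 * l` the Lipschitz constant is `8 * M * l ≤ 1 / 2`. The same bound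
  -- keeps the Picard iterates in this ball, since `l + 8 * M * l * (2 * l) ≤ 2 * l`.
  have hstep : ∀ d, 4 * (2 * l) * d * M = 8 * M * l * d := fun d => by ring
  have hbd : ∀ k x v, |f k x v| ≤ 2 * l := fun k => by
    induction k with
    | zero => intro x v; simpa [f] using hl0
    | succ k ih =>
      intro x v
      rw [hsucc]
      have h1 := abs_duhamel_sub_datum_le (φ := φ) hΩ hB hM (hmeas k) ih x v
      have h2 : |duhamel Ω B φ (f k) x v| ≤ |duhamel Ω B φ (f k) x v - φ v| + |φ v| := by
        simpa using abs_add_le (duhamel Ω B φ (f k) x v - φ v) (φ v)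
      have h3 := hφl v
      nlinarith
  have hdist : ∀ k x v, dist (f k x v) (f (k + 1) x v) ≤ 2 * l * (1 / 2) ^ k := fun k => by
    induction k with
    | zero =>
      intro x v
      simpa [f, Real.dist_eq, duhamel_zero] using (hφl v).trans (by linarith)
    | succ k ih =>
      intro x v
      have hk : f (k + 1) x v = duhamel Ω B φ (f k) x v := by rw [hsucc]
      rw [hsucc (k + 1), hk, dist_comm, Real.dist_eq]
      refine (abs_duhamel_sub_le (φ := φ) hΩ hB hM (hmeas (k + 1)) (hmeas k) (hbd _) (hbd _)
        (d := 2 * l * (1 / 2) ^ k) (fun x w => ?_) x v).trans ?_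
      · rw [← Real.dist_eq, dist_comm]; exact ih x w
      · rw [hstep, pow_succ]
        have : 0 ≤ 2 * l * (1 / 2) ^ k := by positivity
        nlinarith
  have hlim : ∀ x v, ∃ a, Tendsto (fun k => f k x v) atTop (𝓝 a) := fun x v =>
    cauchySeq_tendsto_of_complete
      (cauchySeq_of_le_geometric (1 / 2) (2 * l) (by norm_num) fun k => hdist k x v)
  choose F hF using hlim
  have hFm : Measurable (Function.uncurry F) :=
    measurable_of_tendsto_metrizable hmeas (tendsto_pi_nhds.2 fun p => hF p.1 p.2)
  have hFb : ∀ x v, |F x v| ≤ 2 * l := fun x v =>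
    le_of_tendsto (hF x v).abs (Eventually.of_forall fun k => hbd k x v)
  have hrate : ∀ k x v, |F x v - f k x v| ≤ 4 * l * (1 / 2) ^ k := fun k x v => by
    have h1 := dist_le_of_le_geometric_of_tendsto (1 / 2) (2 * l) (by norm_num)
      (fun k => hdist k x v) (hF x v) k
    rw [dist_comm, Real.dist_eq] at h1
    refine h1.trans (le_of_eq ?_)
    ring
  refine ⟨F, hFm, hFb, fun x v => tendsto_nhds_unique ((tendsto_add_atTop_iff_nat 1).2 (hF x v)) ?_⟩
  rw [tendsto_iff_norm_sub_tendsto_zero]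
  have hzero : Tendsto (fun k : ℕ => 8 * M * l * (4 * l * (1 / 2 : ℝ) ^ k)) atTop (𝓝 0) := by
    simpa using ((tendsto_pow_atTop_nhds_zero_of_lt_one (by norm_num : (0 : ℝ) ≤ 1 / 2)
      (by norm_num)).const_mul (4 * l)).const_mul (8 * M * l)
  refine squeeze_zero (fun _ => norm_nonneg _) (fun k => ?_) hzero
  rw [hsucc, norm_sub_rev, ← hstep]
  exact abs_duhamel_sub_le (φ := φ) hΩ hB hM hFm (hmeas k) hFb (hbd k) (hrate k) x v

lemma transport_of_eq_duhamel (hΩ : IsSmoothBoundedDomain Ω) (hB : IsContinuousKernel B)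
    (hM : MassBound Ω B M) {F : Space n → Space n → ℝ} (hF : Measurable (Function.uncurry F))
    {r : ℝ} (hFr : ∀ x w, |F x w| ≤ r) (hfix : ∀ x v, F x v = duhamel Ω B φ F x v)
    {x v : Space n} (hv : v ≠ 0) {t : ℝ} (ht : 0 ≤ t) (hseg : ∀ s ∈ Icc 0 t, x + s • v ∈ Ω) :
    F (x + t • v) v - F x v = ∫ s in (0 : ℝ)..t, collision B F F (x + s • v) v := by
  rw [hfix (x + t • v) v, hfix x v, duhamel, duhamel, setIntegral_backwardTimes_add hΩ.isOpen hv ht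
    hseg (f := fun y => collision B F F y v)
    (integrableOn_collision hΩ hB hM hF hFr (x + t • v) v)]
  ring

lemma velocity_ne_zero_of_mem_outgoing {p : Space n × Space n} (hp : p ∈ outgoing Ω) : p.2 ≠ 0 := by
  obtain ⟨-, ν, -, hν⟩ := hp
  rintro h
  simp [h] at hν

lemma tendsto_inflow_of_eq_duhamel (hΩ : IsSmoothBoundedDomain Ω) (hB : IsContinuousKernel B)
    (hM : MassBound Ω B M) {F : Space n → Space n → ℝ} (hF : Measurable (Function.uncurry F))
    {r : ℝ} (hFr : ∀ x w, |F x w| ≤ r) (hfix : ∀ x v, F x v = duhamel Ω B φ F x v)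
    {p : Space n × Space n} (hp : p ∈ incoming Ω) :
    Tendsto (fun t : ℝ => F (p.1 + t • p.2) p.2) (𝓝[>] 0) (𝓝 (φ p.2)) := by
  have hv : p.2 ≠ 0 := by
    simpa using velocity_ne_zero_of_mem_outgoing (mem_incoming_iff_neg_mem_outgoing.1 hp)
  have hnot : p.1 ∉ Ω := by
    have := hp.1
    rw [hΩ.isOpen.frontier_eq] at this
    exact this.2
  set C := 4 * r * r * (kernelMass B p.2).toReal
  have hlim : Tendsto (fun t : ℝ => C * t) (𝓝[>] 0) (𝓝 0) := by
    have : ContinuousAt (fun t : ℝ => C * t) 0 := by fun_prop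
    simpa using this.tendsto.mono_left nhdsWithin_le_nhds
  rw [tendsto_iff_norm_sub_tendsto_zero]
  refine squeeze_zero' (Eventually.of_forall fun _ => norm_nonneg _) ?_ hlim
  filter_upwards [self_mem_nhdsWithin] with t ht
  have ht0 : (0 : ℝ) < t := ht
  rw [hfix, duhamel, add_sub_cancel_left]
  -- The past of `p.1 + t • p.2` cannot reach beyond `p.1 ∉ Ω`, so it lasts less than `t`.
  have hsub : backwardTimes Ω (p.1 + t • p.2) p.2 ⊆ Ioo 0 t := fun s hs =>
    ⟨hs.2.1, not_le.1 fun hle => hnot (by simpa using hs.2.2 t ⟨ht0.le, hle⟩)⟩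
  have hC : 0 ≤ C := (abs_nonneg _).trans
    (abs_collision_le hB (hM.ne_top _ hv) (x := p.1) hF.of_uncurry_left (hFr _))
  refine (norm_setIntegral_le_of_norm_le_const
    (volume_backwardTimes_ne_top hΩ.isBounded _ _).lt_top fun s _ =>
      abs_collision_le hB (hM.ne_top _ hv) hF.of_uncurry_left (hFr _)).trans ?_
  refine mul_le_mul_of_nonneg_left ?_ hC
  refine (measureReal_mono hsub measure_Ioo_lt_top.ne).trans ?_
  simp [ht0.le]

/-- From an interior point shortly before the exit, `F` along the trajectory is a constant plus the
primitive of a bounded function, hence continuous up to the exit. -/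
lemma exists_trace_of_eq_duhamel (hΩ : IsSmoothBoundedDomain Ω) (hB : IsContinuousKernel B)
    (hM : MassBound Ω B M) {F : Space n → Space n → ℝ} (hF : Measurable (Function.uncurry F))
    {r : ℝ} (hFr : ∀ x w, |F x w| ≤ r) (hfix : ∀ x v, F x v = duhamel Ω B φ F x v)
    {p : Space n × Space n} (hp : p ∈ outgoing Ω) :
    ∃ a, Tendsto (fun t : ℝ => F (p.1 - t • p.2) p.2) (𝓝[>] 0) (𝓝 a) := by
  have hv := velocity_ne_zero_of_mem_outgoing hp
  obtain ⟨T, hT, hmem⟩ := mem_nhdsGT_iff_exists_Ioc_subset.1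
    (eventually_sub_mem_of_mem_outgoing hΩ.isOpen hp)
  have hT0 : (0 : ℝ) < T := hT
  set x := p.1 - T • p.2 with hx
  set q : ℝ → ℝ := fun s => collision B F F (x + s • p.2) p.2
  have hint : ∀ a b, IntervalIntegrable q volume a b := fun a b => by
    refine (intervalIntegrable_const (c := 4 * r * r * (kernelMass B p.2).toReal)).mono_fun' ?_
      (Eventually.of_forall fun s =>
        abs_collision_le hB (hM.ne_top _ hv) hF.of_uncurry_left (hFr _))
    exact ((measurable_collision hB hF).comp (by fun_prop :
      Measurable fun s : ℝ => (x + s • p.2, p.2))).aestronglyMeasurable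
  have hcont := intervalIntegral.continuous_primitive hint 0
  have hc2 : ContinuousAt (fun t : ℝ => F x p.2 + ∫ s in (0 : ℝ)..(T - t), q s) 0 :=
    (continuous_const.add (hcont.comp (continuous_const.sub continuous_id))).continuousAt
  refine ⟨_, (hc2.tendsto.mono_left nhdsWithin_le_nhds).congr' ?_⟩
  filter_upwards [Ioo_mem_nhdsGT hT0] with t ht
  rw [← transport_of_eq_duhamel hΩ hB hM hF hFr hfix hv (x := x) (by linarith [ht.2])
    fun s hs => ?_]
  · rw [add_sub_cancel]
    congr 1
    rw [hx]; module
  · convert hmem (⟨by linarith [ht.1, hs.2], by linarith [hs.1]⟩ : T - s ∈ Ioc 0 T) using 1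
    rw [mem_ofPred_eq, hx]
    congr! 1
    module

/-- One more iteration: `F` differs from `φ` by at most `16 * M * l ^ 2`, so replacing `F` by `φ` in
the collision term costs `4 * (2 * l) * (16 * M * l ^ 2) * M`. With `φ` independent of position the
remaining time integral is a length times a constant. -/
lemma abs_sub_expansion_le (hΩ : IsSmoothBoundedDomain Ω) (hB : IsContinuousKernel B)
    (hM : MassBound Ω B M) (hφ : Measurable φ) {l : ℝ} (hφl : ∀ w, |φ w| ≤ l)
    {F : Space n → Space n → ℝ} (hF : Measurable (Function.uncurry F))
    (hFr : ∀ x w, |F x w| ≤ 2 * l) (hfix : ∀ x v, F x v = duhamel Ω B φ F x v) (x v : Space n) :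
    |F x v - (φ v + volume.real (backwardTimes Ω x v) *
      collision B (fun _ => φ) (fun _ => φ) 0 v)| ≤ 128 * M ^ 2 * l ^ 3 := by
  have hl0 : 0 ≤ l := (abs_nonneg _).trans (hφl 0)
  have h1 : ∀ x w, |F x w - φ w| ≤ 16 * M * l ^ 2 := fun x w => by
    have := abs_duhamel_sub_datum_le (φ := φ) hΩ hB hM hF hFr x w
    rw [← hfix] at this
    linarith
  have h2 : duhamel Ω B φ (fun _ => φ) x v = φ v + volume.real (backwardTimes Ω x v) *
      collision B (fun _ => φ) (fun _ => φ) 0 v := by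
    have : ∀ y, collision B (fun _ => φ) (fun _ => φ) y v =
        collision B (fun _ => φ) (fun _ => φ) 0 v := fun _ => rfl
    simp only [duhamel, this, setIntegral_const, smul_eq_mul]
  have h3 := abs_duhamel_sub_le (φ := φ) hΩ hB hM hF (K := fun _ => φ) (hφ.comp measurable_snd)
    hFr (fun _ w => (hφl w).trans (by linarith)) h1 x v
  rw [← hfix, h2] at h3
  linarith

/-- Solvability for small data `φ(v)`, and the second order expansion of the measurement. -/
theorem exists_isMeasurement (hΩ : IsSmoothBoundedDomain Ω) (hB : IsContinuousKernel B)
    (hM : MassBound Ω B M) (hφ : Measurable φ) {l δ : ℝ} (hφl : ∀ w, |φ w| ≤ l)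
    (hl : 16 * M * l ≤ 1) (hδ : 2 * l ≤ δ) :
    ∃ h, IsMeasurement Ω B δ (fun p => φ p.2) h ∧ ∀ x v T, (x, v) ∈ outgoing Ω → 0 < T →
      (∀ s ∈ Ioo 0 T, x - s • v ∈ Ω) → x - T • v ∉ Ω →
      |h (x, v) - (φ v + T * collision B (fun _ => φ) (fun _ => φ) 0 v)| ≤
        128 * M ^ 2 * l ^ 3 := by
  obtain ⟨F, hF, hFr, hfix⟩ := exists_eq_duhamel hΩ hB hM hφ hφl hl
  have htr : ∀ p, ∃ a, p ∈ outgoing Ω →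
      Tendsto (fun t : ℝ => F (p.1 - t • p.2) p.2) (𝓝[>] 0) (𝓝 a) := fun p => by
    by_cases hp : p ∈ outgoing Ω
    · obtain ⟨a, ha⟩ := exists_trace_of_eq_duhamel hΩ hB hM hF hFr hfix hp
      exact ⟨a, fun _ => ha⟩
    -- The value off `Γ₊` is immaterial.
    · exact ⟨0, fun h => absurd h hp⟩
  choose h hh using htr
  refine ⟨h, ⟨F, ⟨hF, fun x _ v => (hFr x v).trans hδ, fun x _ v hv t ht hseg =>
    transport_of_eq_duhamel hΩ hB hM hF hFr hfix hv ht hseg, fun p hp =>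
    tendsto_inflow_of_eq_duhamel hΩ hB hM hF hFr hfix hp⟩, hh⟩, fun x v T hp hT hmem hout => ?_⟩
  have hv : v ≠ 0 := velocity_ne_zero_of_mem_outgoing hp
  set Q := collision B (fun _ => φ) (fun _ => φ) 0 v
  have hc : ContinuousAt (fun t : ℝ => φ v + (T - t) * Q) 0 := by fun_prop
  have hlim := ((hh _ hp).sub (hc.tendsto.mono_left nhdsWithin_le_nhds)).abs
  rw [sub_zero] at hlim
  -- Expand at the interior point `x - t • v`, whose past lasts `T - t`, and let `t ↓ 0`.
  refine le_of_tendsto hlim ?_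
  filter_upwards [Ioo_mem_nhdsGT hT] with t ht
  have h1 := abs_sub_expansion_le hΩ hB hM hφ hφl hF hFr hfix (x - t • v) v
  rwa [backwardTimes_eq_Ioo hv ht.1 hmem hout ht.2, Real.volume_real_Ioo_of_le (by linarith [ht.2]),
    sub_zero] at h1

end Duhamel

/-! ### Recovering the kernel -/

lemma collision_const_mul (B : Kernel n) (φ : Space n → ℝ) (l : ℝ) (x v : Space n) :
    collision B (fun _ w => l * φ w) (fun _ w => l * φ w) x v =
      l ^ 2 * collision B (fun _ => φ) (fun _ => φ) x v := by
  unfold collision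
  simp only [← integral_const_mul]
  refine integral_congr_ae (Eventually.of_forall fun u => integral_congr_ae
    (Eventually.of_forall fun ω => ?_))
  simp only
  ring

/-- Identical measurements imply that the collision operators agree on functions of the velocity. -/
theorem SameMeasurements.collision_eq (hΩ : IsSmoothBoundedDomain Ω) {B₁ B₂ : Kernel n}
    (hB₁ : IsContinuousKernel B₁) (hB₂ : IsContinuousKernel B₂) (hb₁ : KernelBound Ω B₁)
    (hb₂ : KernelBound Ω B₂) (hmeas : SameMeasurements Ω B₁ B₂) {v : Space n} (hv : v ≠ 0)
    {φ : Space n → ℝ} (hφ : Continuous φ) (hφ1 : ∀ w, |φ w| ≤ 1) :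
    collision B₁ (fun _ => φ) (fun _ => φ) 0 v = collision B₂ (fun _ => φ) (fun _ => φ) 0 v := by
  obtain ⟨M₁, hM₁⟩ := hb₁.exists_massBound hΩ.isOpen hΩ.isConnected.nonempty
  obtain ⟨M₂, hM₂⟩ := hb₂.exists_massBound hΩ.isOpen hΩ.isConnected.nonempty
  obtain ⟨x, hx⟩ := exists_mem_transversalOutgoing hΩ hv
  obtain ⟨hxout, T, hT, hin, hchord⟩ := id hx
  have hnot : x - T • v ∉ Ω := by
    have := hin.1
    rw [hΩ.isOpen.frontier_eq] at this
    exact this.2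
  obtain ⟨ε, hε, δ, hδ, hsame⟩ := hmeas
  set Q₁ := collision B₁ (fun _ => φ) (fun _ => φ) 0 v
  set Q₂ := collision B₂ (fun _ => φ) (fun _ => φ) 0 v
  set C := 128 * M₁ ^ 2 + 128 * M₂ ^ 2
  have hsmall : ∀ c a : ℝ, 0 < a → ∀ᶠ l : ℝ in 𝓝[>] 0, c * l ≤ a := fun c a ha => by
    have hc : ContinuousAt (fun l : ℝ => c * l) 0 := by fun_prop
    exact nhdsWithin_le_nhds ((hc.eventually_lt_const (by simpa using ha)).mono fun _ h => h.le)
  -- The first order terms agree, so the second order terms differ by at most the two cubic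
  -- remainders; dividing by `l ^ 2` leaves a factor `l`.
  have hkey : ∀ᶠ l : ℝ in 𝓝[>] 0, T * |Q₁ - Q₂| ≤ C * l := by
    filter_upwards [hsmall (16 * M₁) 1 one_pos, hsmall (16 * M₂) 1 one_pos, hsmall 2 δ hδ,
      hsmall 1 ε hε, self_mem_nhdsWithin] with l h1 h2 h3 h4 hl
    have hl0 : (0 : ℝ) < l := hl
    have hbd : ∀ w, |l * φ w| ≤ l := fun w => by
      rw [abs_mul, abs_of_pos hl0]
      exact mul_le_of_le_one_right hl0.le (hφ1 w)
    have hm : Measurable fun w => l * φ w := hφ.measurable.const_mul l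
    obtain ⟨h₁, hh₁, he₁⟩ := exists_isMeasurement hΩ hB₁ hM₁ hm hbd h1 h3
    obtain ⟨h₂, hh₂, he₂⟩ := exists_isMeasurement hΩ hB₂ hM₂ hm hbd h2 h3
    have heq := hsame (fun p => l * φ p.2) (by fun_prop)
      (fun p _ => (hbd p.2).trans (by linarith)) h₁ h₂ hh₁ hh₂ hx
    have e₁ := he₁ x v T hxout hT hchord hnot
    have e₂ := he₂ x v T hxout hT hchord hnot
    rw [collision_const_mul] at e₁ e₂
    rw [heq] at e₁
    have h5 : l ^ 2 * (T * |Q₁ - Q₂|) ≤ l ^ 2 * (C * l) := by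
      have h6 : l ^ 2 * (T * |Q₁ - Q₂|) = |(h₂ (x, v) - (l * φ v + T * (l ^ 2 * Q₂))) -
          (h₂ (x, v) - (l * φ v + T * (l ^ 2 * Q₁)))| := by
        rw [← abs_of_pos hT, ← abs_of_pos (pow_pos hl0 2), ← abs_mul, ← abs_mul, abs_of_pos hT,
          abs_of_pos (pow_pos hl0 2)]
        congr 1
        ring
      rw [h6]
      refine (abs_sub _ _).trans ((add_le_add e₂ e₁).trans (le_of_eq ?_))
      ring
    exact le_of_mul_le_mul_left h5 (pow_pos hl0 2)
  have hlim : Tendsto (fun l : ℝ => C * l) (𝓝[>] 0) (𝓝 0) := by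
    have hc : ContinuousAt (fun l : ℝ => C * l) 0 := by fun_prop
    simpa using hc.tendsto.mono_left nhdsWithin_le_nhds
  have h0 : T * |Q₁ - Q₂| ≤ 0 := ge_of_tendsto hlim hkey
  have h1 : |Q₁ - Q₂| ≤ 0 := nonpos_of_mul_nonpos_right h0 hT
  exact sub_eq_zero.1 (abs_nonpos_iff.1 h1)

lemma ae_notMem_translate (v : Space n) {W : Submodule ℝ (Space n)} (hW : W ≠ ⊤) :
    ∀ᵐ u : Space n, u - v ∉ W := by
  have h := Measure.addHaar_affineSubspace (volume : Measure (Space n)) (AffineSubspace.mk' v W)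
    (fun htop => hW (by
      rw [← AffineSubspace.direction_mk' v W, htop, AffineSubspace.direction_top]))
  refine measure_mono_null (fun u hu => ?_) h
  simpa [AffineSubspace.mem_mk'] using hu

/-- For almost all collisions neither `u` nor a velocity after the collision equals `v`. -/
lemma ae_collision_ne (hn : 2 ≤ n) (v : Space n) :
    ∀ᵐ q ∂(collisionMeasure n), uPrime v q.1 q.2 ≠ v ∧ vPrime v q.1 q.2 ≠ v ∧ q.1 ≠ v := by
  have hmeas : MeasurableSet {q : Space n × USphere n |
      uPrime v q.1 q.2 ≠ v ∧ vPrime v q.1 q.2 ≠ v ∧ q.1 ≠ v} :=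
    ((measurable_uPrime v) (measurableSet_singleton v).compl).inter
      (((measurable_vPrime v) (measurableSet_singleton v).compl).inter
        (measurable_fst (measurableSet_singleton v).compl))
  -- Fix `ω` and vary `u`: the exceptional `u` lie on the line `v + ℝ ω` (for `u' = v` or `u = v`)
  -- or on the hyperplane `v + ω^⊥` (for `v' = v`). The line is a null set because `n ≥ 2`.
  refine (Measure.ae_prod_iff_ae_ae hmeas).2 ((Measure.ae_ae_comm hmeas).2
    (Eventually.of_forall fun ω => ?_))
  have hω : ‖(ω : Space n)‖ = 1 := by simp
  have hω0 : (ω : Space n) ≠ 0 := fun h => by simp [h] at hω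
  have hline : Submodule.span ℝ {(ω : Space n)} ≠ ⊤ := fun htop => by
    have h1 := finrank_span_singleton (K := ℝ) hω0
    rw [htop, finrank_top, finrank_euclideanSpace_fin] at h1
    omega
  have hplane : (Submodule.span ℝ {(ω : Space n)})ᗮ ≠ ⊤ := fun htop => by
    have h1 : (ω : Space n) ∈ (Submodule.span ℝ {(ω : Space n)})ᗮ := by rw [htop]; trivial
    rw [Submodule.mem_orthogonal_singleton_iff_inner_right, inner_self_eq_zero] at h1
    exact hω0 h1
  filter_upwards [ae_notMem_translate v hline, ae_notMem_translate v hplane] with u h1 h2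
  refine ⟨fun h => h1 ?_, fun h => h2 ?_, fun h => h1 (by simp [h])⟩
  · refine Submodule.mem_span_singleton.2 ⟨inner ℝ (u - v) (ω : Space n), ?_⟩
    unfold uPrime at h
    rw [sub_eq_iff_eq_add] at h
    nth_rewrite 2 [h]
    abel
  · unfold vPrime at h
    rw [add_eq_left, smul_eq_zero, or_iff_left hω0] at h
    rwa [Submodule.mem_orthogonal_singleton_iff_inner_left]

/-- A continuous bump at `v` of height `1 / 2` and width `1 / k`. -/
noncomputable def spike (v : Space n) (k : ℕ) (w : Space n) : ℝ := max 0 (1 - k * ‖w - v‖) / 2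

lemma continuous_spike (v : Space n) (k : ℕ) : Continuous (spike v k) := by
  unfold spike; fun_prop

lemma abs_spike_le (v : Space n) (k : ℕ) (w : Space n) : |spike v k w| ≤ 1 / 2 := by
  unfold spike
  rw [abs_of_nonneg (by positivity)]
  have : max 0 (1 - k * ‖w - v‖) ≤ 1 := max_le zero_le_one (by simp; positivity)
  linarith

lemma spike_self (v : Space n) (k : ℕ) : spike v k v = 1 / 2 := by simp [spike]

lemma eventually_spike_eq_zero {v w : Space n} (h : w ≠ v) : ∀ᶠ k in atTop, spike v k w = 0 := by
  have hpos : 0 < ‖w - v‖ := norm_pos_iff.2 (sub_ne_zero.2 h)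
  obtain ⟨N, hN⟩ := exists_nat_gt (1 / ‖w - v‖)
  filter_upwards [eventually_ge_atTop N] with k hk
  have h1 : (1 : ℝ) ≤ k * ‖w - v‖ := by
    rw [← div_le_iff₀ hpos]
    exact hN.le.trans (by exact_mod_cast hk)
  simp [spike, h1]

/-- The collision operator on `ψ` with its value at `v` raised by `1 / 2`, as a limit. -/
lemma tendsto_collision_add_spike (hn : 2 ≤ n) {B : Kernel n} (hB : IsContinuousKernel B)
    {v : Space n} (hm : kernelMass B v ≠ ∞) {ψ : Space n → ℝ} (hψ : Continuous ψ)
    (hψb : ∀ w, |ψ w| ≤ 1 / 2) :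
    Tendsto (fun k => collision B (fun _ w => ψ w + spike v k w) (fun _ w => ψ w + spike v k w) 0 v)
      atTop (𝓝 (collision B (fun _ => ψ) (fun _ => ψ) 0 v -
        (∫ q, B v q.1 q.2 * ψ q.1 ∂(collisionMeasure n)) / 2)) := by
  have hbd : ∀ k w, |ψ w + spike v k w| ≤ 1 := fun k w =>
    (abs_add_le _ _).trans (by linarith [hψb w, abs_spike_le v k w])
  have hmk : ∀ k, Measurable fun w => ψ w + spike v k w := fun k =>
    (hψ.add (continuous_spike v k)).measurable
  have hint : Integrable (fun q : Space n × USphere n => B v q.1 q.2 * ψ q.1) (collisionMeasure n) :=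
    (integrable_kernel hB hm).mul_bdd (hψ.measurable.comp measurable_fst).aestronglyMeasurable
      (Eventually.of_forall fun q => hψb q.1)
  have hlim : collision B (fun _ => ψ) (fun _ => ψ) 0 v -
      (∫ q, B v q.1 q.2 * ψ q.1 ∂(collisionMeasure n)) / 2 =
      ∫ q, (B v q.1 q.2 * (collisionBracket ψ v q - ψ q.1 / 2)) ∂(collisionMeasure n) := by
    rw [collision_eq_integral hB hm hψ.measurable hψb, ← integral_div,
      ← integral_sub (integrable_kernel_mul_bracket hB hm hψ.measurable hψb) (hint.div_const 2)]
    congr 1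
    ext q
    ring
  rw [hlim]
  simp_rw [fun k => collision_eq_integral hB hm (F := fun _ w => ψ w + spike v k w) (x := 0)
    (hmk k) (hbd k)]
  refine tendsto_integral_of_dominated_convergence (fun q => ‖B v q.1 q.2‖ * (4 * 1 * 1))
    (fun k => (integrable_kernel_mul_bracket hB hm (hmk k) (hbd k)).aestronglyMeasurable)
    ((integrable_kernel hB hm).norm.mul_const _) (fun k => Eventually.of_forall fun q => ?_) ?_
  · rw [norm_mul]
    exact mul_le_mul_of_nonneg_left (abs_collisionBracket_le (hbd k) v q) (norm_nonneg _)
  -- For almost every collision the spike eventually vanishes at `u'`, `v'` and `u`, so the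
  -- integrand is constant from some `k` on; only the factor at `v` keeps the extra `1 / 2`.
  · filter_upwards [ae_collision_ne hn v] with q hq
    refine tendsto_const_nhds.congr' ?_
    filter_upwards [eventually_spike_eq_zero hq.1, eventually_spike_eq_zero hq.2.1,
      eventually_spike_eq_zero hq.2.2] with k h1 h2 h3
    simp only [collisionBracket, h1, h2, h3, spike_self]
    ring

/-- Identical measurements determine `∫∫ B(v, u, ω) ψ(u) dω du`. -/
theorem SameMeasurements.integral_mul_eq_zero (hn : 2 ≤ n) (hΩ : IsSmoothBoundedDomain Ω)
    {B₁ B₂ : Kernel n} (hB₁ : IsContinuousKernel B₁) (hB₂ : IsContinuousKernel B₂)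
    (hb₁ : KernelBound Ω B₁) (hb₂ : KernelBound Ω B₂) (hmeas : SameMeasurements Ω B₁ B₂)
    {v : Space n} (hv : v ≠ 0) {ψ : Space n → ℝ} (hψ : Continuous ψ)
    (hψb : ∀ w, |ψ w| ≤ 1 / 2) :
    Integrable (fun q : Space n × USphere n => (B₁ v q.1 q.2 - B₂ v q.1 q.2) * ψ q.1)
      (collisionMeasure n) ∧
    ∫ q, (B₁ v q.1 q.2 - B₂ v q.1 q.2) * ψ q.1 ∂(collisionMeasure n) = 0 := by
  obtain ⟨M₁, hM₁⟩ := hb₁.exists_massBound hΩ.isOpen hΩ.isConnected.nonempty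
  obtain ⟨M₂, hM₂⟩ := hb₂.exists_massBound hΩ.isOpen hΩ.isConnected.nonempty
  have hint : ∀ {B : Kernel n}, IsContinuousKernel B → kernelMass B v ≠ ∞ →
      Integrable (fun q : Space n × USphere n => B v q.1 q.2 * ψ q.1) (collisionMeasure n) :=
    fun hB hm => (integrable_kernel hB hm).mul_bdd
      (hψ.measurable.comp measurable_fst).aestronglyMeasurable
      (Eventually.of_forall fun q => hψb q.1)
  have hi₁ := hint hB₁ (hM₁.ne_top v hv)
  have hi₂ := hint hB₂ (hM₂.ne_top v hv)
  have heq := fun {φ : Space n → ℝ} (hφ : Continuous φ) (hφb : ∀ w, |φ w| ≤ 1) =>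
    hmeas.collision_eq hΩ hB₁ hB₂ hb₁ hb₂ hv hφ hφb
  have hl₁ := tendsto_collision_add_spike hn hB₁ (hM₁.ne_top v hv) hψ hψb
  have hl₂ := tendsto_collision_add_spike hn hB₂ (hM₂.ne_top v hv) hψ hψb
  rw [← heq hψ fun w => (hψb w).trans (by norm_num)] at hl₂
  -- The bounds `1 / 2` on `ψ` and on the spike keep the sum an admissible datum of size at most
  -- `1`.
  have hlim := tendsto_nhds_unique (hl₁.congr fun k =>
    heq (hψ.add (continuous_spike v k)) fun w =>
      (abs_add_le _ _).trans (by linarith [hψb w, abs_spike_le v k w])) hl₂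
  simp only [sub_mul]
  exact ⟨hi₁.sub hi₂, by rw [integral_sub hi₁ hi₂]; linarith⟩

/-- If `ψ(u)` makes `(B₁ - B₂)(v, u, ω) ψ(u)` nonnegative, identical measurements make this product
vanish. -/
theorem SameMeasurements.mul_eq_zero (hn : 2 ≤ n) (hΩ : IsSmoothBoundedDomain Ω)
    {B₁ B₂ : Kernel n} (hB₁ : IsContinuousKernel B₁) (hB₂ : IsContinuousKernel B₂)
    (hb₁ : KernelBound Ω B₁) (hb₂ : KernelBound Ω B₂) (hmeas : SameMeasurements Ω B₁ B₂)
    {v : Space n} (hv : v ≠ 0) {ψ : Space n → ℝ} (hψ : Continuous ψ)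
    (hψb : ∀ w, |ψ w| ≤ 1 / 2) (hnn : ∀ u ω, 0 ≤ (B₁ v u ω - B₂ v u ω) * ψ u)
    (u : Space n) (ω : USphere n) : (B₁ v u ω - B₂ v u ω) * ψ u = 0 := by
  obtain ⟨hi, h0⟩ := hmeas.integral_mul_eq_zero hn hΩ hB₁ hB₂ hb₁ hb₂ hv hψ hψb
  have hae := (integral_eq_zero_iff_of_nonneg (fun q : Space n × USphere n => hnn q.1 q.2) hi).1 h0
  have hc : Continuous fun q : Space n × USphere n => (B₁ v q.1 q.2 - B₂ v q.1 q.2) * ψ q.1 :=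
    ((hB₁.continuous_fixed v).sub (hB₂.continuous_fixed v)).mul (hψ.comp continuous_fst)
  -- `du dω` charges every nonempty open set, so a continuous function that vanishes almost
  -- everywhere vanishes identically.
  exact congrFun ((hc.ae_eq_iff_eq (collisionMeasure n) continuous_zero).1 hae) (u, ω)

lemma kernel_ext_of_ne_zero (hn : 2 ≤ n) {B₁ B₂ : Kernel n} (hB₁ : IsContinuousKernel B₁)
    (hB₂ : IsContinuousKernel B₂) (h : ∀ v, v ≠ 0 → ∀ u ω, B₁ v u ω = B₂ v u ω) : B₁ = B₂ := by
  have : Nonempty (Fin n) := ⟨⟨0, by omega⟩⟩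
  have : NeBot (𝓝[≠] (0 : Space n)) := Module.punctured_nhds_neBot ℝ (Space n) 0
  funext v u ω
  have hc : ∀ {B : Kernel n}, IsContinuousKernel B → Continuous fun v => B v u ω := fun hB =>
    hB.comp (by fun_prop : Continuous fun v : Space n => (v, u, ω))
  exact congrFun ((hc hB₁).ext_on (dense_compl_singleton (0 : Space n)) (hc hB₂)
    fun w hw => h w hw u ω) v

end Boltzmann

open Boltzmann

theorem corollary1p3 (n : ℕ) (hn : 2 ≤ n) (Ω : Set (Boltzmann.Space n))
    (hΩ : Boltzmann.IsSmoothBoundedDomain Ω) (B₁ B₂ : Boltzmann.Kernel n)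
    (hcont₁ : Boltzmann.IsContinuousKernel B₁) (hcont₂ : Boltzmann.IsContinuousKernel B₂)
    (hbound₁ : Boltzmann.KernelBound Ω B₁) (hbound₂ : Boltzmann.KernelBound Ω B₂)
    (hsymm₁ : Boltzmann.KernelSymmetric B₁) (hsymm₂ : Boltzmann.KernelSymmetric B₂)
    (hmeas : Boltzmann.SameMeasurements Ω B₁ B₂) :
    (Boltzmann.IndependentOfAngle B₁ → Boltzmann.IndependentOfAngle B₂ → B₁ = B₂) ∧
    ((∀ v u ω, B₂ v u ω ≤ B₁ v u ω) → B₁ = B₂) := by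
  refine ⟨fun hi₁ hi₂ => kernel_ext_of_ne_zero hn hcont₁ hcont₂ fun v hv u ω => ?_,
    fun hle => kernel_ext_of_ne_zero hn hcont₁ hcont₂ fun v hv u ω => ?_⟩
  -- The difference `D` depends on `u` alone. The test function is `D` scaled to size at most `1 /
  -- 2` with its sign kept, so the integrand is `D ^ 2 / (2 * (1 + |D|)) ≥ 0`.
  · set D : Space n → ℝ := fun w => B₁ v w ω - B₂ v w ω with hD
    have hDc : Continuous D :=
      ((hcont₁.continuous_fixed v).comp (Continuous.prodMk_left ω)).sub
        ((hcont₂.continuous_fixed v).comp (Continuous.prodMk_left ω))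
    have hpos : ∀ w, 0 < 2 * (1 + |D w|) := fun w => by positivity
    have h := hmeas.mul_eq_zero hn hΩ hcont₁ hcont₂ hbound₁ hbound₂ hv
      (ψ := fun w => D w / (2 * (1 + |D w|)))
      (hDc.div (by fun_prop) fun w => (hpos w).ne') (fun w => by
        rw [abs_div, abs_of_pos (hpos w), div_le_iff₀ (hpos w)]
        linarith) (fun w ω' => by
        rw [hi₁ v w ω' ω, hi₂ v w ω' ω, ← mul_div_assoc]
        exact div_nonneg (mul_self_nonneg (D w)) (hpos w).le) u ω
    rw [← mul_div_assoc, div_eq_zero_iff, or_iff_left (hpos u).ne'] at h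
    exact sub_eq_zero.1 (mul_self_eq_zero.1 h)
  -- `B₁ - B₂` already has a sign, so a constant test function suffices.
  · have h := hmeas.mul_eq_zero hn hΩ hcont₁ hcont₂ hbound₁ hbound₂ hv
      (ψ := fun _ => 1 / 2) continuous_const (fun _ => by norm_num)
      (fun w ω' => mul_nonneg (sub_nonneg.2 (hle v w ω')) (by norm_num)) u ω
    exact sub_eq_zero.1 ((mul_eq_zero_iff_right (by norm_num)).1 h)
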